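/- Assume the Riemann Hypothesis. Let $0<t_1\le t_2\le t_3\le\dots$ be the ordinates of the non-trivial zeros of $\zeta$ in the upper half plane, each listed as often as its multiplicity, so that the non-trivial zeros of $\zeta$ are exactly the numbers $\tfrac12\pm i t_n$, $n\ge 1$. Let $(\log|\zeta|)^{(k)}(\tfrac12)$ be the $k$-th derivative of $x\mapsto\log|\zeta(x)|$ ($x$ real) at $x=\tfrac12$, let $\beta(s)=\sum_{n\ge 0}(-1)^n(2n+1)^{-s}$ for $s>1$, and let $\chi_4$ be the non-trivial Dirichlet character modulo $4$. For $m\ge 1$ and real $A,B$ put $$V_m(A,B)=\frac{(-1)^{m+1}}{2}\left[\frac{1}{(2m-1)!}(\log|\zeta|)^{(2m)}\big(\tfrac12\big)-2^{2m+1}+2^{2m-1}(A+B)\right].$$ (i) For every integer $m\ge 1$ the following products over the primes $p\ge 3$ converge unconditionally, and $$(1-2^{-2m})\zeta(2m)=\prod_{p\ge 3}\big(1-p^{-2m}\big)^{-1},\qquad \beta(2m)=\prod_{p\ge 3}\big(1-\chi_4(p)p^{-2m}\big)^{-1}.$$ (ii) For every integer $m\ge 1$, $$\sum_{k=1}^{\infty}\frac{1}{t_k^{2m}}=V_m\Big((1-2^{-2m})\zeta(2m),\,\beta(2m)\Big)=V_m\Big(\prod_{p\ge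 3}(1-p^{-2m})^{-1},\ \prod_{p\ge 3}(1-\chi_4(p)p^{-2m})^{-1}\Big).$$ (iii) For every integer $n\ge 0$, $$t_{n+1}=\lim_{m\to\infty}\left[V_m\Big((1-2^{-2m})\zeta(2m),\,\beta(2m)\Big)-\sum_{k=1}^{n}\frac{1}{t_k^{2m}}\right]^{-\frac1{2m}},$$ and consequently, in terms of the primes, $$t_{n+1}=\lim_{m\to\infty}\left[V_m\Big(\prod_{p\ge 3}(1-p^{-2m})^{-1},\ \prod_{p\ge 3}(1-\chi_4(p)p^{-2m})^{-1}\Big)-\sum_{k=1}^{n}\frac{1}{t_k^{2m}}\right]^{-\frac1{2m}}.$$ -/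

import Mathlib

open Filter Topology

noncomputable section

/-- The number of non-trivial zeros `ρ` of the Riemann zeta function with `0 < Im ρ ≤ T`,
counted with multiplicity. -/
def zetaZeroCount (T : ℝ) : ℕ :=
  ∑ᶠ ρ ∈ {ρ : ℂ | riemannZeta ρ = 0 ∧ 0 < ρ.re ∧ ρ.re < 1 ∧ 0 < ρ.im ∧ ρ.im ≤ T},
    analyticOrderNatAt riemannZeta ρ

/-- The ordinate `t_n` (`n ≥ 1`) of the `n`-th non-trivial zero in the upper half plane: the zeros
are listed by non-decreasing imaginary part, each one as often as its multiplicity. -/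
def zetaOrdinate (n : ℕ) : ℝ := sInf {T : ℝ | n ≤ zetaZeroCount T}

/-- `(log |ζ|)^{(k)}(1/2)`: the `k`-th derivative at `1/2` of `x ↦ log |ζ(x)|`, `x` real. -/
def logAbsZetaDeriv (k : ℕ) : ℝ :=
  iteratedDeriv k (fun x : ℝ => Real.log ‖riemannZeta (x : ℂ)‖) (1 / 2)

/-- The Dirichlet beta function `β(s) = ∑_{n ≥ 0} (-1)^n / (2n+1)^s`, used for real `s > 1`
where the series converges absolutely. -/
def dirichletBeta (s : ℝ) : ℝ := ∑' n : ℕ, (-1 : ℝ) ^ n / (2 * (n : ℝ) + 1) ^ s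

/-- The primes `p ≥ 3`. -/
abbrev OddPrimes : Type := {p : ℕ // p.Prime ∧ 3 ≤ p}

/-- The factor `(1 - p^{-2m})⁻¹`. -/
def zetaEulerFactor (m : ℕ) (p : OddPrimes) : ℝ :=
  (1 - 1 / ((p : ℕ) : ℝ) ^ (2 * m))⁻¹

/-- The factor `(1 - χ₄(p) p^{-2m})⁻¹`, with `χ₄` the non-trivial Dirichlet character mod `4`. -/
def betaEulerFactor (m : ℕ) (p : OddPrimes) : ℝ :=
  (1 - (ZMod.χ₄ ((p : ℕ) : ZMod 4) : ℝ) / ((p : ℕ) : ℝ) ^ (2 * m))⁻¹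

/-- The expression of Voros type (for `m ≥ 1`)
`(-1)^{m+1}/2 · [ (log|ζ|)^{(2m)}(1/2) / (2m-1)! - 2^{2m+1} + 2^{2m-1} (A + B) ]`. -/
def vorosExpression (m : ℕ) (A B : ℝ) : ℝ :=
  (-1) ^ (m + 1) / 2 *
    (1 / ((2 * m - 1).factorial : ℝ) * logAbsZetaDeriv (2 * m) - 2 ^ (2 * m + 1)
      + 2 ^ (2 * m - 1) * (A + B))

end

noncomputable section

/-! Everything is read off the entire function `riemannXi`, ξ(s) = s(s-1)Λ(s), by computing the
derivatives of order 2m of log ξ at 1/2 in two ways. No branch of the logarithm is needed: the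
quantity used is the derivative of order 2m-1 of ξ'/ξ.

On the side of the zeros, ξ grows at most like exp(O(R log R)). Divide ξ by its zeros in the disc of
radius R about 1/2. The quotient is zero-free there, so Borel–Carathéodory and Cauchy bound the
derivatives of its logarithm of order at least 2 by a quantity tending to 0. This is
`tendsto_sum_zeros_iteratedDeriv_logDeriv`, which replaces the Hadamard product. Under RH the zeros
are 1/2 ± it and (1/2-ρ)^(2m) = (-1)^m t^(2m), so the sum over zeros is a multiple of the power sum
of the ordinates (`RiemannHypothesis.hasSum_zetaOrdinate`).

On the side of the factorization ξ = s(s-1)·`Gammaℝ`·ζ, the factors s and s-1 give the term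
-2^(2m+1) and ζ gives the derivative of log|ζ|. The poles of `Gammaℝ` at 0, -2, -4, ... give a
multiple of the sum of (4n+1)^(-2m), which is the average of (1-2^(-2m))ζ(2m) and β(2m)
(`vorosExpression_eq`). Both of these values have Euler products over the odd primes.

Two facts are not supplied by RH: ξ(1/2) ≠ 0, proved by a numerical bound on a theta integral, and
the infinitude of the zeros, proved by comparing factorial with exponential growth. The limit
formulas follow because the smallest remaining ordinate dominates the power sums as m grows
(`tendsto_rpow_inv_power_sum`). -/

/-! ### Logarithmic derivatives and their Cauchy estimates. -/

open Metric in
/-- A zero-free holomorphic function on a disc has a holomorphic logarithm there. -/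
theorem exists_log_of_ne_zero_on_ball {g : ℂ → ℂ} {c : ℂ} {r : ℝ} (hr : 0 < r)
    (hg : DifferentiableOn ℂ g (ball c r)) (h0 : ∀ z ∈ ball c r, g z ≠ 0) :
    ∃ L : ℂ → ℂ, L c = 0 ∧ (∀ z ∈ ball c r, HasDerivAt L (logDeriv g z) z) ∧
      ∀ z ∈ ball c r, g z = g c * Complex.exp (L z) := by
  have hd : DifferentiableOn ℂ (logDeriv g) (ball c r) :=
    (hg.deriv isOpen_ball).div hg h0
  obtain ⟨L, hL0, hL⟩ := hd.isExactOn_ball.with_val_at c 0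
  refine ⟨L, hL0, hL, fun z hz => ?_⟩
  have hder : ∀ w ∈ ball c r, HasDerivAt (fun w => g w * Complex.exp (-L w)) 0 w := by
    intro w hw
    have hgw := (hg.differentiableAt (isOpen_ball.mem_nhds hw)).hasDerivAt
    have := hgw.mul ((hL w hw).neg.cexp)
    refine this.congr_deriv ?_
    rw [logDeriv_apply, Pi.neg_apply]
    field_simp [h0 w hw]
    ring
  have hconst : g z * Complex.exp (-L z) = g c * Complex.exp (-L c) := by
    refine (convex_ball c r).is_const_of_fderivWithin_eq_zero (𝕜 := ℂ)
      (f := fun w => g w * Complex.exp (-L w))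
      (fun w hw => (hder w hw).differentiableAt.differentiableWithinAt) (fun w hw => ?_)
      hz (mem_ball_self hr)
    rw [fderivWithin_of_isOpen isOpen_ball hw]
    ext
    simpa using (hder w hw).deriv
  rw [hL0, neg_zero, Complex.exp_zero, mul_one] at hconst
  rw [← hconst, mul_assoc, ← Complex.exp_add]
  simp

open Metric in
/-- Cauchy estimate for the derivatives of the logarithmic derivative of a zero-free function of
controlled growth. -/
theorem norm_iteratedDeriv_logDeriv_le {g : ℂ → ℂ} {c : ℂ} {r M : ℝ} (hr : 0 < r) (hM : 0 < M)
    (hg : DifferentiableOn ℂ g (ball c r)) (h0 : ∀ z ∈ ball c r, g z ≠ 0)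
    (hb : ∀ z ∈ ball c r, ‖g z‖ ≤ ‖g c‖ * Real.exp M) (k : ℕ) :
    ‖iteratedDeriv k (logDeriv g) c‖ ≤ (k + 1).factorial * (2 * M) / (r / 2) ^ (k + 1) := by
  obtain ⟨L, hL0, hL, hexp⟩ := exists_log_of_ne_zero_on_ball hr hg h0
  have hc : c ∈ ball c r := mem_ball_self hr
  have hdiff : DifferentiableOn ℂ L (ball c r) :=
    fun z hz => (hL z hz).differentiableAt.differentiableWithinAt
  have hre : ∀ z ∈ ball c r, (L z).re ≤ M := by
    intro z hz
    have h1 := hb z hz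
    rw [hexp z hz, norm_mul, Complex.norm_exp] at h1
    have := le_of_mul_le_mul_left h1 (norm_pos_iff.2 (h0 c hc))
    exact Real.exp_le_exp.1 this
  have hmaps : ∀ z ∈ ball (0 : ℂ) r, c + z ∈ ball c r := by
    intro z hz; simpa [mem_ball, dist_eq_norm] using hz
  -- Borel–Carathéodory turns the one-sided bound on Re L into a bound on |L|; at half the radius
  -- its constant is 2M(r/2)/(r - r/2) = 2M.
  have hsphere : ∀ z ∈ sphere c (r / 2), ‖L z‖ ≤ 2 * M := by
    intro z hz
    have hz' : ‖z - c‖ = r / 2 := by simpa [dist_eq_norm] using hz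
    have := Complex.borelCaratheodory_zero (f := fun w => L (c + w)) (M := M) (R := r)
      (z := z - c) hM
      (hdiff.comp ((differentiable_const c).add differentiable_id).differentiableOn hmaps)
      (fun w hw => hre _ (hmaps w hw)) hr
      (by simp only [mem_ball_zero_iff, hz']; linarith) (by simpa using hL0)
    simp only [add_sub_cancel, hz'] at this
    refine this.trans (le_of_eq ?_)
    field_simp
    ring
  have hcl : DiffContOnCl ℂ L (ball c (r / 2)) := by
    refine (hdiff.mono ?_).diffContOnCl_ball (U := closedBall c (r / 2)) subset_rfl
    exact closedBall_subset_ball (by linarith)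
  have key := Complex.norm_iteratedDeriv_le_of_forall_mem_sphere_norm_le (k + 1)
    (half_pos hr) hcl hsphere
  have heq : iteratedDeriv (k + 1) L c = iteratedDeriv k (logDeriv g) c := by
    rw [iteratedDeriv_succ']
    refine Filter.EventuallyEq.iteratedDeriv_eq k ?_
    filter_upwards [isOpen_ball.mem_nhds hc] with z hz using (hL z hz).deriv
  rwa [heq] at key

theorem AnalyticAt.logDeriv {f : ℂ → ℂ} {c : ℂ} (hf : AnalyticAt ℂ f c) (h0 : f c ≠ 0) :
    AnalyticAt ℂ (_root_.logDeriv f) c :=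
  hf.deriv.div hf h0

/-- The logarithmic derivative is additive throughout a neighbourhood of c, not only at c, so the
identity can be differentiated. -/
theorem iteratedDeriv_logDeriv_mul {f g : ℂ → ℂ} {c : ℂ} (hf : AnalyticAt ℂ f c)
    (hg : AnalyticAt ℂ g c) (hf0 : f c ≠ 0) (hg0 : g c ≠ 0) (k : ℕ) :
    iteratedDeriv k (logDeriv (fun z => f z * g z)) c
      = iteratedDeriv k (logDeriv f) c + iteratedDeriv k (logDeriv g) c := by
  have h : logDeriv (fun z => f z * g z) =ᶠ[𝓝 c] logDeriv f + logDeriv g := by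
    filter_upwards [hf.eventually_analyticAt, hg.eventually_analyticAt,
      hf.continuousAt.eventually_ne hf0, hg.continuousAt.eventually_ne hg0] with z h1 h2 h3 h4
    exact logDeriv_mul z h3 h4 h1.differentiableAt h2.differentiableAt
  rw [h.iteratedDeriv_eq k]
  exact iteratedDeriv_add (hf.logDeriv hf0).contDiffAt (hg.logDeriv hg0).contDiffAt

theorem iteratedDeriv_logDeriv_prod {ι : Type*} (S : Finset ι) {f : ι → ℂ → ℂ} {c : ℂ}
    (hf : ∀ i ∈ S, AnalyticAt ℂ (f i) c) (hf0 : ∀ i ∈ S, f i c ≠ 0) (k : ℕ) :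
    iteratedDeriv k (logDeriv (fun z => ∏ i ∈ S, f i z)) c
      = ∑ i ∈ S, iteratedDeriv k (logDeriv (f i)) c := by
  classical
  induction S using Finset.induction_on with
  | empty =>
    have : logDeriv (fun _ : ℂ => (1 : ℂ)) = fun _ => 0 := by ext z; simp [logDeriv_apply]
    simp [this]
  | insert a S ha ih =>
    simp only [Finset.prod_insert ha, Finset.sum_insert ha]
    rw [iteratedDeriv_logDeriv_mul (hf a (by simp))
      (Finset.analyticAt_fun_prod S fun i hi => hf i (by simp [hi])) (hf0 a (by simp))
      (Finset.prod_ne_zero_iff.2 fun i hi => hf0 i (by simp [hi])),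
      ih (fun i hi => hf i (by simp [hi])) (fun i hi => hf0 i (by simp [hi]))]

theorem iteratedDeriv_logDeriv_sub (a c : ℂ) (k : ℕ) :
    iteratedDeriv k (logDeriv (fun z => z - a)) c
      = (-1) ^ k * k.factorial * ((c - a) ^ (k + 1))⁻¹ := by
  have : logDeriv (fun z => z - a) = fun z => (1 * z - a)⁻¹ := by
    ext z; simp [logDeriv_apply]
  rw [this, iteratedDeriv_eq_iterate, iter_deriv_inv_linear_sub]
  simp only [one_pow, mul_one, one_mul]
  rw [← zpow_natCast (c - a), ← zpow_neg]
  congr 2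
  push_cast; ring

theorem iteratedDeriv_logDeriv_sub_pow {a c : ℂ} (h : c ≠ a) (n k : ℕ) :
    iteratedDeriv k (logDeriv (fun z => (z - a) ^ n)) c
      = n * ((-1) ^ k * k.factorial * ((c - a) ^ (k + 1))⁻¹) := by
  have := iteratedDeriv_logDeriv_prod (Finset.range n) (f := fun _ z => z - a) (c := c)
    (fun _ _ => by fun_prop) (fun _ _ => sub_ne_zero.2 h) k
  simpa [iteratedDeriv_logDeriv_sub] using this

/-! ### Removing zeros from entire functions; partial fractions. -/

theorem analyticOrderAt_ne_top_of_differentiable {f : ℂ → ℂ} (hf : Differentiable ℂ f) {c : ℂ}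
    (hc : f c ≠ 0) (a : ℂ) : analyticOrderAt f a ≠ ⊤ :=
  AnalyticOnNhd.analyticOrderAt_ne_top_of_isPreconnected (U := Set.univ)
    (fun z _ => hf.analyticAt z) isPreconnected_univ (Set.mem_univ c) (Set.mem_univ a)
    (by rw [(hf.analyticAt c).analyticOrderAt_eq_zero.2 hc]; simp)

/-- Splitting off one zero of an entire function. -/
theorem exists_eq_sub_pow_mul {f : ℂ → ℂ} (hf : Differentiable ℂ f) {a : ℂ}
    (ha : analyticOrderAt f a ≠ ⊤) :
    ∃ g : ℂ → ℂ, Differentiable ℂ g ∧ (∀ z, f z = (z - a) ^ analyticOrderNatAt f a * g z) ∧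
      g a ≠ 0 := by
  classical
  obtain ⟨g₀, hg₀, hg₀a, hfg⟩ := (hf.analyticAt a).analyticOrderAt_ne_top.1 ha
  set n := analyticOrderNatAt f a
  -- The quotient has a removable singularity at a; the local factor `g₀` supplies the missing
  -- value.
  let g : ℂ → ℂ := Function.update (fun z => f z / (z - a) ^ n) a (g₀ a)
  have hne : ∀ z, z ≠ a → g z = f z / (z - a) ^ n := fun z hz => Function.update_of_ne hz _ _
  have hga : g a = g₀ a := Function.update_self _ _ _
  have hloc : g =ᶠ[𝓝 a] g₀ := by
    filter_upwards [hfg] with z hz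
    rcases eq_or_ne z a with rfl | h
    · exact hga
    · rw [hne z h, hz, smul_eq_mul, mul_div_cancel_left₀]
      exact pow_ne_zero _ (sub_ne_zero.2 h)
  refine ⟨g, fun z => ?_, fun z => ?_, by rwa [hga]⟩
  · rcases eq_or_ne z a with rfl | h
    · exact (hg₀.congr hloc.symm).differentiableAt
    · have h1 : g =ᶠ[𝓝 z] fun z => f z / (z - a) ^ n := by
        filter_upwards [isOpen_ne.mem_nhds h] with w hw using hne w hw
      refine DifferentiableAt.congr_of_eventuallyEq ?_ h1
      exact (hf z).div (by fun_prop) (pow_ne_zero _ (sub_ne_zero.2 h))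
  · rcases eq_or_ne z a with rfl | h
    · rw [hga]; simpa using hfg.self_of_nhds
    · rw [hne z h, mul_div_cancel₀]
      exact pow_ne_zero _ (sub_ne_zero.2 h)

/-- Splitting off finitely many zeros of an entire function. -/
theorem exists_eq_prod_sub_pow_mul {f : ℂ → ℂ} (hf : Differentiable ℂ f) {c : ℂ} (hc : f c ≠ 0)
    (S : Finset ℂ) :
    ∃ g : ℂ → ℂ, Differentiable ℂ g ∧
      (∀ z, f z = (∏ a ∈ S, (z - a) ^ analyticOrderNatAt f a) * g z) ∧
      ∀ z, (z ∈ S ∨ f z ≠ 0) → g z ≠ 0 := by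
  classical
  suffices h : ∃ g : ℂ → ℂ, Differentiable ℂ g ∧
      (∀ z, f z = (∏ a ∈ S, (z - a) ^ analyticOrderNatAt f a) * g z) ∧ ∀ z ∈ S, g z ≠ 0 by
    obtain ⟨g, hg, hfg, hS⟩ := h
    refine ⟨g, hg, hfg, fun z hz => hz.elim (hS z) fun h h0 => h ?_⟩
    rw [hfg, h0, mul_zero]
  induction S using Finset.induction_on with
  | empty => exact ⟨f, hf, by simp, by simp⟩
  | insert a S ha ih =>
    obtain ⟨g, hg, hfg, hS⟩ := ih
    have hP : AnalyticAt ℂ (fun z => ∏ b ∈ S, (z - b) ^ analyticOrderNatAt f b) a :=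
      Finset.analyticAt_fun_prod S fun b _ => by fun_prop
    have hP0 : (∏ b ∈ S, (a - b) ^ analyticOrderNatAt f b) ≠ 0 :=
      Finset.prod_ne_zero_iff.2 fun b hb =>
        pow_ne_zero _ (sub_ne_zero.2 fun h => ha (h ▸ hb))
    -- The factors already removed do not vanish at the new point, so the exponent for the quotient
    -- is still the order of f itself.
    have hord : analyticOrderAt f a = analyticOrderAt g a := by
      have : f = (fun z => ∏ b ∈ S, (z - b) ^ analyticOrderNatAt f b) * g := funext hfg
      conv_lhs => rw [this]
      rw [analyticOrderAt_mul hP (hg.analyticAt a), hP.analyticOrderAt_eq_zero.2 hP0, zero_add]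
    have hordN : analyticOrderNatAt f a = analyticOrderNatAt g a := by
      simp [analyticOrderNatAt, hord]
    obtain ⟨h, hh, hgh, hha⟩ := exists_eq_sub_pow_mul hg (a := a)
      (hord ▸ analyticOrderAt_ne_top_of_differentiable hf hc a)
    refine ⟨h, hh, fun z => ?_, fun z hz => ?_⟩
    · rw [hfg, Finset.prod_insert ha, hgh, hordN]; ring
    · rcases Finset.mem_insert.1 hz with rfl | hz
      · exact hha
      · intro h0
        apply hS z hz
        rw [hgh, h0, mul_zero]

open Metric in
/-- If the zeros split off an entire function lie in a disc, the quotient grows on the concentric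
disc of triple radius at most like the function itself. -/
theorem norm_le_of_eq_prod_sub_pow_mul {f g : ℂ → ℂ} (hg : Differentiable ℂ g) {c : ℂ}
    (hc : f c ≠ 0) {S : Finset ℂ} {n : ℂ → ℕ} (hfg : ∀ z, f z = (∏ a ∈ S, (z - a) ^ n a) * g z)
    {R M : ℝ} (hR : 0 < R) (hS : ∀ a ∈ S, dist a c ≤ R)
    (hM : ∀ z ∈ closedBall c (3 * R), ‖f z‖ ≤ Real.exp M) {z : ℂ} (hz : z ∈ ball c (3 * R)) :
    ‖g z‖ ≤ ‖g c‖ * Real.exp (M - Real.log ‖f c‖) := by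
  have hfc : 0 < ‖f c‖ := norm_pos_iff.2 hc
  have hPc : 0 < ‖∏ a ∈ S, (c - a) ^ n a‖ := by
    rw [norm_pos_iff]; intro h; apply hc; rw [hfg, h, zero_mul]
  have hcl : z ∈ closure (ball c (3 * R)) := subset_closure hz
  refine Complex.norm_le_of_forall_mem_frontier_norm_le isBounded_ball hg.diffContOnCl ?_ hcl
  intro w hw
  rw [frontier_ball c (by positivity)] at hw
  have hw' : ‖w - c‖ = 3 * R := by simpa [dist_eq_norm] using hw
  -- On the circle of radius 3R, |w - a| ≥ 3R - R ≥ R ≥ |c - a|, so removing the zeros costs nothing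
  -- compared with the centre; the maximum principle carries the bound inside.
  have hP : ‖∏ a ∈ S, (c - a) ^ n a‖ ≤ ‖∏ a ∈ S, (w - a) ^ n a‖ := by
    simp only [norm_prod, norm_pow]
    refine Finset.prod_le_prod (fun _ _ => by positivity) fun a ha => ?_
    have h1 := hS a ha
    rw [dist_eq_norm] at h1
    have h2 : ‖w - c‖ ≤ ‖w - a‖ + ‖a - c‖ := norm_sub_le_norm_sub_add_norm_sub w a c
    gcongr
    rw [norm_sub_rev c a]
    linarith
  have h1 := hM w (sphere_subset_closedBall hw)
  rw [Real.exp_sub, Real.exp_log hfc, hfg c, norm_mul]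
  rw [hfg w, norm_mul] at h1
  have hgc : 0 < ‖g c‖ := by
    rw [norm_pos_iff]; intro h; apply hc; rw [hfg, h, mul_zero]
  calc ‖g w‖ = ‖∏ a ∈ S, (c - a) ^ n a‖ * ‖g w‖ / ‖∏ a ∈ S, (c - a) ^ n a‖ := by
        field_simp
    _ ≤ Real.exp M / ‖∏ a ∈ S, (c - a) ^ n a‖ := by
        gcongr
        exact (mul_le_mul_of_nonneg_right hP (norm_nonneg _)).trans h1
    _ = ‖g c‖ * (Real.exp M / (‖∏ a ∈ S, (c - a) ^ n a‖ * ‖g c‖)) := by field_simp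

open Metric in
/-- Partial fraction expansion of the derivatives of the logarithmic derivative of an entire
function whose logarithm grows more slowly than `R ^ 2`. -/
theorem tendsto_sum_zeros_iteratedDeriv_logDeriv {f : ℂ → ℂ} (hf : Differentiable ℂ f) {c : ℂ}
    (hc : f c ≠ 0) {M : ℝ → ℝ} (hM : ∀ R, 0 < R → ∀ z ∈ closedBall c R, ‖f z‖ ≤ Real.exp (M R))
    (hMo : Tendsto (fun R => M R / R ^ 2) atTop (𝓝 0)) {Z : ℝ → Finset ℂ}
    (hZ : ∀ R a, a ∈ Z R ↔ f a = 0 ∧ dist a c ≤ R) {k : ℕ} (hk : 1 ≤ k) :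
    Tendsto (fun R => ∑ a ∈ Z R, analyticOrderNatAt f a *
      ((-1) ^ k * k.factorial * ((c - a) ^ (k + 1))⁻¹)) atTop
      (𝓝 (iteratedDeriv k (logDeriv f) c)) := by
  set K : ℝ := (k + 1).factorial * 2 * 2 ^ (k + 1) with hK
  rw [tendsto_iff_norm_sub_tendsto_zero]
  -- The growth of f is sampled on radius 3R, and 9 = 3² restores the normalization by R².
  have hbound : Tendsto (fun R : ℝ => K * (9 * (|M (3 * R)| / (3 * R) ^ 2)
      + (|Real.log ‖f c‖| + 1) / R ^ 2)) atTop (𝓝 0) := by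
    have h1 : Tendsto (fun R : ℝ => |M (3 * R)| / (3 * R) ^ 2) atTop (𝓝 0) := by
      have := (hMo.comp (tendsto_id.const_mul_atTop (show (0 : ℝ) < 3 by norm_num))).abs
      simp only [abs_zero] at this
      refine this.congr fun R => ?_
      simp [abs_div, mul_pow]
    have h2 : Tendsto (fun R : ℝ => (|Real.log ‖f c‖| + 1) / R ^ 2) atTop (𝓝 0) :=
      tendsto_const_nhds.div_atTop (tendsto_pow_atTop two_ne_zero)
    simpa using ((h1.const_mul 9).add h2).const_mul K
  refine squeeze_zero' (Eventually.of_forall fun _ => norm_nonneg _) ?_ hbound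
  filter_upwards [eventually_ge_atTop (1 : ℝ)] with R hR
  have hR0 : 0 < R := by linarith
  obtain ⟨g, hg, hfg, hg0⟩ := exists_eq_prod_sub_pow_mul hf hc (Z R)
  -- The summand 1 only secures the strict positivity that the Borel–Carathéodory estimate requires.
  set M' : ℝ := |M (3 * R)| + |Real.log ‖f c‖| + 1 with hM'
  have hM'0 : 0 < M' := by positivity
  have hne : ∀ z ∈ ball c R, g z ≠ 0 := by
    intro z hz
    refine hg0 z ?_
    by_cases h : f z = 0
    · exact Or.inl ((hZ R z).2 ⟨h, (mem_ball.1 hz).le⟩)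
    · exact Or.inr h
  have hgb : ∀ z ∈ ball c R, ‖g z‖ ≤ ‖g c‖ * Real.exp M' := by
    intro z hz
    refine (norm_le_of_eq_prod_sub_pow_mul hg hc hfg hR0 (fun a ha => ((hZ R a).1 ha).2)
      (hM (3 * R) (by positivity)) (ball_subset_ball (by linarith) hz)).trans ?_
    gcongr
    linarith [le_abs_self (M (3 * R)), neg_le_abs (Real.log ‖f c‖)]
  have key := norm_iteratedDeriv_logDeriv_le hR0 hM'0 hg.differentiableOn hne hgb k
  have hca : ∀ a ∈ Z R, c ≠ a := by
    rintro a ha rfl; exact hc ((hZ R c).1 ha).1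
  have hsum : iteratedDeriv k (logDeriv f) c = (∑ a ∈ Z R, analyticOrderNatAt f a *
      ((-1) ^ k * k.factorial * ((c - a) ^ (k + 1))⁻¹)) + iteratedDeriv k (logDeriv g) c := by
    have : f = fun z => (∏ a ∈ Z R, (z - a) ^ analyticOrderNatAt f a) * g z := funext hfg
    have hpow0 : ∀ a ∈ Z R, (c - a) ^ analyticOrderNatAt f a ≠ 0 :=
      fun a ha => pow_ne_zero _ (sub_ne_zero.2 (hca a ha))
    refine (congrArg (fun h => iteratedDeriv k (logDeriv h) c) this).trans ?_
    rw [iteratedDeriv_logDeriv_mul (Finset.analyticAt_fun_prod _ fun a _ => by fun_prop)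
      (hg.analyticAt c) (Finset.prod_ne_zero_iff.2 hpow0) (hne c (mem_ball_self hR0)),
      iteratedDeriv_logDeriv_prod (Z R) (f := fun a z => (z - a) ^ analyticOrderNatAt f a)
        (fun a _ => by fun_prop) hpow0]
    congr 1
    exact Finset.sum_congr rfl fun a ha => iteratedDeriv_logDeriv_sub_pow (hca a ha) _ _
  rw [hsum, sub_add_cancel_left, norm_neg]
  refine key.trans ?_
  -- Here k ≥ 1 enters: growth o(R²) is beaten only from the second derivative of the logarithm
  -- onwards.
  have hpow : R ^ 2 ≤ R ^ (k + 1) := pow_le_pow_right₀ hR (by omega)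
  calc ((k + 1).factorial : ℝ) * (2 * M') / (R / 2) ^ (k + 1) = K * (M' / R ^ (k + 1)) := by
        rw [hK, div_pow]; field_simp
    _ ≤ K * (M' / R ^ 2) := by gcongr
    _ = _ := by rw [hM']; field_simp; ring

/-! ### Derivatives of log |f| along the real axis. -/

/-- Real derivatives of the real part of a holomorphic function along the real axis. -/
theorem iteratedDeriv_re_comp_ofReal {L : ℂ → ℂ} {a : ℝ} (hL : AnalyticAt ℂ L a) (k : ℕ) :
    iteratedDeriv k (fun x : ℝ => (L x).re) =ᶠ[𝓝 a] fun x => (iteratedDeriv k L x).re := by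
  induction k with
  | zero => simp
  | succ k ih =>
    have h1 : ∀ᶠ x : ℝ in 𝓝 a, AnalyticAt ℂ L x :=
      Complex.continuous_ofReal.continuousAt.eventually hL.eventually_analyticAt
    filter_upwards [ih.eventually_nhds, h1] with x hx hLx
    rw [iteratedDeriv_succ, Filter.EventuallyEq.deriv_eq hx, iteratedDeriv_succ]
    have : DifferentiableAt ℂ (iteratedDeriv k L) x := by
      rw [iteratedDeriv_eq_iterate]
      exact (hLx.iterated_deriv k).differentiableAt
    exact this.hasDerivAt.real_of_complex.deriv

open Metric in
/-- Real derivatives of `log |f|` along the real axis. -/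
theorem iteratedDeriv_log_norm {f : ℂ → ℂ} {a : ℝ} (hf : AnalyticAt ℂ f a) (h0 : f a ≠ 0)
    (k : ℕ) :
    iteratedDeriv (k + 1) (fun x : ℝ => Real.log ‖f x‖) a
      = (iteratedDeriv k (logDeriv f) a).re := by
  obtain ⟨r, hr, hball⟩ := eventually_nhds_iff_ball.1
    (hf.eventually_analyticAt.and (hf.continuousAt.eventually_ne h0))
  obtain ⟨L, hL0, hL, hexp⟩ := exists_log_of_ne_zero_on_ball hr
    (fun z hz => (hball z hz).1.differentiableAt.differentiableWithinAt)
    (fun z hz => (hball z hz).2)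
  have hnhds : ball (a : ℂ) r ∈ 𝓝 (a : ℂ) := ball_mem_nhds _ hr
  have hLa : AnalyticAt ℂ L a := by
    have : DifferentiableOn ℂ L (ball (a : ℂ) r) :=
      fun z hz => (hL z hz).differentiableAt.differentiableWithinAt
    exact this.analyticAt hnhds
  have h1 : (fun x : ℝ => Real.log ‖f x‖)
      =ᶠ[𝓝 a] fun x : ℝ => (L x + (Real.log ‖f a‖ : ℝ)).re := by
    filter_upwards [Complex.continuous_ofReal.continuousAt.eventually hnhds] with x hx
    rw [hexp x hx, norm_mul, Complex.norm_exp,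
      Real.log_mul (norm_ne_zero_iff.2 h0) (Real.exp_pos _).ne', Real.log_exp]
    simp [add_comm]
  rw [h1.iteratedDeriv_eq, (iteratedDeriv_re_comp_ofReal (L := fun z => L z + (Real.log ‖f a‖ : ℝ))
    (hLa.add analyticAt_const) (k + 1)).self_of_nhds, iteratedDeriv_succ']
  refine congrArg Complex.re (Filter.EventuallyEq.iteratedDeriv_eq k ?_)
  filter_upwards [hnhds] with z hz
  simpa using (hL z hz).deriv

/-! ### The archimedean factor. -/

theorem tendsto_log_div_self_atTop : Tendsto (fun x : ℝ => Real.log x / x) atTop (𝓝 0) :=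
  Real.isLittleO_log_id_atTop.tendsto_div_nhds_zero

theorem Complex.norm_Gamma_le_Gamma_re {s : ℂ} (hs : 0 < s.re) :
    ‖Complex.Gamma s‖ ≤ Real.Gamma s.re := by
  rw [Complex.Gamma_eq_integral hs, Real.Gamma_eq_integral hs, Complex.GammaIntegral]
  refine (MeasureTheory.norm_integral_le_integral_norm _).trans (le_of_eq ?_)
  refine MeasureTheory.setIntegral_congr_fun measurableSet_Ioi fun x hx => ?_
  have hx : 0 < x := hx
  simp only [norm_mul, Complex.norm_real, Real.norm_eq_abs, abs_of_pos (Real.exp_pos _)]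
  rw [Complex.norm_cpow_eq_rpow_re_of_pos hx]
  simp

/-- `Γ` on the real axis is bounded by `n ^ n` up to the abscissa `n + 1`. -/
theorem Real.Gamma_le_exp_mul_log {x : ℝ} {n : ℕ} (hx : 2 ≤ x) (hxn : x ≤ n + 1) (hn : 1 ≤ n) :
    Real.Gamma x ≤ Real.exp (n * Real.log n) := by
  have hn0 : (0 : ℝ) < n := by exact_mod_cast hn
  calc Real.Gamma x ≤ Real.Gamma (n + 1) :=
        Real.Gamma_strictMonoOn_Ici.monotoneOn hx (Set.mem_Ici.2 (hx.trans hxn)) hxn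
    _ = n.factorial := Real.Gamma_nat_eq_factorial n
    _ ≤ (n : ℝ) ^ n := by exact_mod_cast Nat.factorial_le_pow n
    _ = Real.exp (n * Real.log n) := by
        rw [mul_comm, Real.exp_mul, Real.exp_log hn0, Real.rpow_natCast]

-- On the disc of radius N about 1/2 the function Γ(s/2 + N) is holomorphic, zero-free and at most
-- exp(2N log 2N), while its value at the centre is at least 1. The Cauchy estimate then gives O(log
-- N / N).
open Metric in
theorem tendsto_iteratedDeriv_logDeriv_Gamma_add_natCast {k : ℕ} (hk : 1 ≤ k) :
    Tendsto (fun N : ℕ => iteratedDeriv k (logDeriv fun s : ℂ => Complex.Gamma (s / 2 + N)) (1 / 2))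
      atTop (𝓝 0) := by
  set K : ℝ := (k + 1).factorial * 2 * 2 ^ (k + 1) with hK
  have hlim : Tendsto (fun N : ℕ => K * (4 * (Real.log ((2 * N : ℕ) : ℝ) / ((2 * N : ℕ) : ℝ))))
      atTop (𝓝 0) := by
    have h2 : Tendsto (fun N : ℕ => 2 * N) atTop atTop :=
      tendsto_id.const_mul_atTop' (by norm_num)
    have := ((tendsto_log_div_self_atTop.comp tendsto_natCast_atTop_atTop).comp h2)
    simpa using (this.const_mul 4).const_mul K
  refine squeeze_zero_norm' ?_ hlim
  -- From N = 4 on, Re(z/2 + N) ≥ 2 on the disc, where the real Gamma function is increasing.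
  filter_upwards [eventually_ge_atTop 4] with N hN
  have hN' : (4 : ℝ) ≤ N := by exact_mod_cast hN
  set M : ℝ := ((2 * N : ℕ) : ℝ) * Real.log ((2 * N : ℕ) : ℝ) with hM
  have h2N : (1 : ℝ) < ((2 * N : ℕ) : ℝ) := by push_cast; linarith
  have hM0 : 0 < M := mul_pos (by linarith) (Real.log_pos h2N)
  have hre : ∀ z ∈ ball (1 / 2 : ℂ) N, 2 ≤ (z / 2 + N).re ∧ (z / 2 + N).re ≤ ((2 * N : ℕ) : ℝ) + 1 := by
    intro z hz
    have h1 := (Complex.abs_re_le_norm (z - 1 / 2)).trans (mem_ball_iff_norm.1 hz).le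
    have h2 : (z / 2 + N).re = (z - 1 / 2).re / 2 + 1 / 4 + N := by
      simp; ring
    rw [h2]
    have := abs_le.1 h1
    push_cast
    constructor <;> linarith
  have hc : (1 / 2 : ℂ) ∈ ball (1 / 2 : ℂ) (N : ℝ) := mem_ball_self (by linarith)
  have hΓc : 1 ≤ ‖Complex.Gamma (1 / 2 / 2 + N)‖ := by
    have h1 : (1 / 2 / 2 + N : ℂ) = ((1 / 4 + N : ℝ) : ℂ) := by push_cast; ring
    rw [h1, Complex.Gamma_ofReal, Complex.norm_real, Real.norm_eq_abs]
    refine le_trans ?_ (le_abs_self _)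
    have h2 : Real.Gamma 2 = 1 := Real.Gamma_two
    rw [← h2]
    exact Real.Gamma_strictMonoOn_Ici.monotoneOn (Set.mem_Ici.2 le_rfl)
      (Set.mem_Ici.2 (by linarith)) (by linarith)
  have key := norm_iteratedDeriv_logDeriv_le (g := fun s : ℂ => Complex.Gamma (s / 2 + N))
    (c := 1 / 2) (r := N) (M := M) (by linarith) hM0
    (fun z hz => by
      have h1 : DifferentiableAt ℂ Complex.Gamma (z / 2 + N) := by
        refine Complex.differentiableAt_Gamma _ fun m hm => ?_
        have := (hre z hz).1
        rw [hm] at this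
        simp at this
        linarith [(Nat.cast_nonneg m : (0 : ℝ) ≤ m)]
      exact (h1.comp z (by fun_prop)).differentiableWithinAt)
    (fun z hz => Complex.Gamma_ne_zero_of_re_pos (by linarith [(hre z hz).1]))
    (fun z hz => by
      calc ‖Complex.Gamma (z / 2 + N)‖ ≤ Real.Gamma (z / 2 + N).re :=
            Complex.norm_Gamma_le_Gamma_re (by linarith [(hre z hz).1])
        _ ≤ Real.exp M := Real.Gamma_le_exp_mul_log (hre z hz).1 (hre z hz).2 (by omega)
        _ = 1 * Real.exp M := (one_mul _).symm
        _ ≤ _ := by gcongr) k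
  refine key.trans ?_
  have hpow : (N : ℝ) ^ 2 ≤ (N : ℝ) ^ (k + 1) := pow_le_pow_right₀ (by linarith) (by omega)
  calc ((k + 1).factorial : ℝ) * (2 * M) / ((N : ℝ) / 2) ^ (k + 1)
      = K * (M / (N : ℝ) ^ (k + 1)) := by rw [hK, div_pow]; field_simp
    _ ≤ K * (M / (N : ℝ) ^ 2) := by gcongr
    _ = _ := by rw [hM]; push_cast; field_simp; ring

/-- Up to an elementary factor, `Gammaℝ` is a shifted Gamma function divided by linear factors. -/
theorem Gammaℝ_mul_prod_add {s : ℂ} (hs : 0 < s.re) (N : ℕ) :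
    Complex.Gammaℝ s * ∏ n ∈ Finset.range N, (s - (-(2 * n : ℂ)))
      = ((Real.pi : ℂ) ^ (-s / 2) * 2 ^ N) * Complex.Gamma (s / 2 + N) := by
  induction N with
  | zero => simp [Complex.Gammaℝ_def]
  | succ N ih =>
    have h0 : s / 2 + N ≠ 0 := by
      intro h
      have := congrArg Complex.re h
      simp at this
      linarith [(Nat.cast_nonneg N : (0 : ℝ) ≤ N)]
    rw [Finset.prod_range_succ, ← mul_assoc, ih]
    push_cast
    rw [← add_assoc, Complex.Gamma_add_one _ h0]
    ring

theorem iteratedDeriv_const_of_one_le {k : ℕ} (hk : 1 ≤ k) (b c : ℂ) :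
    iteratedDeriv k (fun _ : ℂ => b) c = 0 := by
  rw [iteratedDeriv_const, if_neg (by omega)]

/-- Clearing the first N poles 0, -2, ..., -2(N-1) leaves an elementary factor times Γ(s/2 + N),
whose contribution tends to 0. The minus sign appears because these points are poles rather than
zeros. -/
theorem tendsto_sum_iteratedDeriv_logDeriv_Gammaℝ {k : ℕ} (hk : 1 ≤ k) :
    Tendsto (fun N : ℕ => -∑ n ∈ Finset.range N,
        (-1 : ℂ) ^ k * k.factorial * ((1 / 2 + 2 * n : ℂ) ^ (k + 1))⁻¹) atTop
      (𝓝 (iteratedDeriv k (logDeriv Complex.Gammaℝ) (1 / 2))) := by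
  have hhalf : (0 : ℝ) < (1 / 2 : ℂ).re := by norm_num
  have hΓ : ∀ N : ℕ, AnalyticAt ℂ (fun s : ℂ => Complex.Gamma (s / 2 + N)) (1 / 2) := by
    intro N
    have h1 : ∀ᶠ z : ℂ in 𝓝 (1 / 2), 0 < z.re :=
      Complex.continuous_re.continuousAt.eventually (lt_mem_nhds hhalf)
    rw [Complex.analyticAt_iff_eventually_differentiableAt]
    filter_upwards [h1] with z hz
    have h2 : DifferentiableAt ℂ Complex.Gamma (z / 2 + N) := by
      refine Complex.differentiableAt_Gamma _ fun m hm => ?_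
      have := congrArg Complex.re hm
      simp at this
      linarith [(Nat.cast_nonneg m : (0 : ℝ) ≤ m), (Nat.cast_nonneg N : (0 : ℝ) ≤ N)]
    exact h2.comp z (by fun_prop)
  have hπ0 : (Real.pi : ℂ) ≠ 0 := by exact_mod_cast Real.pi_ne_zero
  have hh : ∀ N : ℕ, AnalyticAt ℂ (fun s : ℂ => (Real.pi : ℂ) ^ (-s / 2) * 2 ^ N) (1 / 2) := by
    intro N
    rw [Complex.analyticAt_iff_eventually_differentiableAt]
    refine Eventually.of_forall fun z => ?_
    exact (DifferentiableAt.const_cpow (by fun_prop) (Or.inl hπ0)).mul_const _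
  have hh0 : ∀ N : ℕ, (Real.pi : ℂ) ^ (-(1 / 2 : ℂ) / 2) * 2 ^ N ≠ 0 := fun N =>
    mul_ne_zero (by simp [Complex.cpow_eq_zero_iff, hπ0]) (pow_ne_zero _ two_ne_zero)
  have hGR : AnalyticAt ℂ Complex.Gammaℝ (1 / 2) := by
    have : Complex.Gammaℝ = fun s => ((Real.pi : ℂ) ^ (-s / 2) * 2 ^ 0)
        * Complex.Gamma (s / 2 + (0 : ℕ)) := by
      ext s; simp [Complex.Gammaℝ_def]
    rw [this]
    exact (hh 0).mul (hΓ 0)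
  -- The elementary factor is the exponential of a linear function, so its logarithmic derivative is
  -- constant and disappears for k ≥ 1.
  have hEh : ∀ N : ℕ, iteratedDeriv k
      (logDeriv (fun s : ℂ => (Real.pi : ℂ) ^ (-s / 2) * 2 ^ N)) (1 / 2) = 0 := by
    intro N
    have : logDeriv (fun s : ℂ => (Real.pi : ℂ) ^ (-s / 2) * 2 ^ N)
        = fun _ => -Complex.log Real.pi / 2 := by
      ext s
      have hd : HasDerivAt (fun s : ℂ => (Real.pi : ℂ) ^ (-s / 2))
          ((Real.pi : ℂ) ^ (-s / 2) * Complex.log Real.pi * (-1 / 2)) s :=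
        HasDerivAt.const_cpow (((hasDerivAt_id s).neg).div_const 2) (Or.inl hπ0)
      have h0 : (Real.pi : ℂ) ^ (-s / 2) ≠ 0 := by simp [Complex.cpow_eq_zero_iff, hπ0]
      rw [logDeriv_apply, (hd.mul_const _).deriv]
      field_simp
    rw [this, iteratedDeriv_const_of_one_le hk]
  have hlin0 : ∀ n : ℕ, (1 / 2 : ℂ) - (-(2 * n : ℂ)) ≠ 0 := by
    intro n h
    have := congrArg Complex.re h
    simp at this
    linarith [(Nat.cast_nonneg n : (0 : ℝ) ≤ n)]
  have key : ∀ N : ℕ, iteratedDeriv k (logDeriv Complex.Gammaℝ) (1 / 2)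
      = (-∑ n ∈ Finset.range N, (-1 : ℂ) ^ k * k.factorial * ((1 / 2 + 2 * n : ℂ) ^ (k + 1))⁻¹)
        + iteratedDeriv k (logDeriv fun s : ℂ => Complex.Gamma (s / 2 + N)) (1 / 2) := by
    intro N
    have hev : (fun s => Complex.Gammaℝ s * ∏ n ∈ Finset.range N, (s - (-(2 * n : ℂ))))
        =ᶠ[𝓝 (1 / 2)] fun s => ((Real.pi : ℂ) ^ (-s / 2) * 2 ^ N) * Complex.Gamma (s / 2 + N) := by
      filter_upwards [Complex.continuous_re.continuousAt.eventually (lt_mem_nhds hhalf)] with z hz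
        using Gammaℝ_mul_prod_add hz N
    have hlog : logDeriv (fun s => Complex.Gammaℝ s * ∏ n ∈ Finset.range N, (s - (-(2 * n : ℂ))))
        =ᶠ[𝓝 (1 / 2)] logDeriv
          fun s => ((Real.pi : ℂ) ^ (-s / 2) * 2 ^ N) * Complex.Gamma (s / 2 + N) := by
      filter_upwards [hev.eventually_nhds] with z hz
      rw [logDeriv_apply, logDeriv_apply, Filter.EventuallyEq.deriv_eq hz, hz.self_of_nhds]
    have h1 := hlog.iteratedDeriv_eq k
    rw [iteratedDeriv_logDeriv_mul hGR (Finset.analyticAt_fun_prod _ fun n _ => by fun_prop)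
        (Complex.Gammaℝ_ne_zero_of_re_pos hhalf) (Finset.prod_ne_zero_iff.2 fun n _ => hlin0 n),
      iteratedDeriv_logDeriv_prod (Finset.range N) (f := fun n s => s - (-(2 * n : ℂ)))
        (fun n _ => by fun_prop) (fun n _ => hlin0 n),
      iteratedDeriv_logDeriv_mul (hh N) (hΓ N) (hh0 N), hEh, zero_add] at h1
    · rw [← h1]
      have h2 : ∀ n ∈ Finset.range N, iteratedDeriv k (logDeriv fun s : ℂ => s - -(2 * (n : ℂ)))
          (1 / 2) = (-1 : ℂ) ^ k * k.factorial * ((1 / 2 + 2 * n : ℂ) ^ (k + 1))⁻¹ := by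
        intro n _
        rw [iteratedDeriv_logDeriv_sub, sub_neg_eq_add]
      rw [Finset.sum_congr rfl h2]
      ring
    · refine Complex.Gamma_ne_zero_of_re_pos ?_
      simp
      positivity
  have h := (tendsto_const_nhds (x := iteratedDeriv k (logDeriv Complex.Gammaℝ) (1 / 2))
    (f := atTop (α := ℕ))).sub (tendsto_iteratedDeriv_logDeriv_Gamma_add_natCast hk)
  rw [sub_zero] at h
  refine h.congr fun N => ?_
  rw [key N]
  ring

/-! ### Enumerating a discrete set of reals with multiplicities. -/

section Enumeration

variable {μ : ℝ → ℕ} {F : ℝ → Finset ℝ} {N : ℝ → ℕ}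

theorem monotone_of_sum_mult (hF : ∀ T t, t ∈ F T ↔ μ t ≠ 0 ∧ t ≤ T)
    (hN : ∀ T, N T = ∑ t ∈ F T, μ t) : Monotone N := by
  intro S T hST
  rw [hN, hN]
  refine Finset.sum_le_sum_of_subset fun t ht => ?_
  rw [hF] at ht ⊢
  exact ⟨ht.1, ht.2.trans hST⟩

/-- The infimum defining the `n`-th element of an enumeration with multiplicities is attained, at a
point of positive multiplicity. -/
theorem exists_isLeast_setOf_le_sum_mult (hF : ∀ T t, t ∈ F T ↔ μ t ≠ 0 ∧ t ≤ T)
    (hN : ∀ T, N T = ∑ t ∈ F T, μ t) (hub : ∀ n, ∃ T, n ≤ N T) {n : ℕ} (hn : 1 ≤ n) :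
    ∃ s, μ s ≠ 0 ∧ IsLeast {T | n ≤ N T} s := by
  have hmono := monotone_of_sum_mult hF hN
  have hmax : ∀ T, n ≤ N T → ∃ s ∈ F T, n ≤ N s := by
    intro T hT
    have hne : (F T).Nonempty := by
      by_contra h
      rw [Finset.not_nonempty_iff_eq_empty] at h
      rw [hN, h, Finset.sum_empty] at hT
      omega
    refine ⟨(F T).max' hne, Finset.max'_mem _ _, ?_⟩
    have hle : F T ⊆ F ((F T).max' hne) := fun t ht =>
      (hF _ _).2 ⟨((hF _ _).1 ht).1, Finset.le_max' _ _ ht⟩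
    rw [hN] at hT ⊢
    exact hT.trans (Finset.sum_le_sum_of_subset hle)
  obtain ⟨T₀, hT₀⟩ := hub n
  obtain ⟨s₀, hs₀, hns₀⟩ := hmax T₀ hT₀
  have hne : ((F T₀).filter fun s => n ≤ N s).Nonempty := ⟨s₀, by simp [hs₀, hns₀]⟩
  set s := ((F T₀).filter fun s => n ≤ N s).min' hne with hs
  have hsmem : s ∈ (F T₀).filter fun s => n ≤ N s := Finset.min'_mem _ hne
  rw [Finset.mem_filter] at hsmem
  refine ⟨s, ((hF _ _).1 hsmem.1).1, hsmem.2, fun T hT => ?_⟩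
  obtain ⟨s', hs', hns'⟩ := hmax T hT
  have hs'T := (hF _ _).1 hs'
  rcases le_total T₀ T with h | h
  · exact ((hF _ _).1 hsmem.1).2.trans h
  · exact (Finset.min'_le _ _ (by simp [hns', (hF T₀ s').2 ⟨hs'T.1, hs'T.2.trans h⟩])).trans hs'T.2

/-- This is the Galois connection between enumeration and counting function, from which order and
multiplicities are read off. It fails for n = 0, where the set is all of ℝ and `sInf` takes the
default value 0. -/
theorem sInf_setOf_le_sum_mult_le_iff (hF : ∀ T t, t ∈ F T ↔ μ t ≠ 0 ∧ t ≤ T)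
    (hN : ∀ T, N T = ∑ t ∈ F T, μ t) (hub : ∀ n, ∃ T, n ≤ N T) {n : ℕ} (hn : 1 ≤ n) (T : ℝ) :
    sInf {T | n ≤ N T} ≤ T ↔ n ≤ N T := by
  obtain ⟨s, -, hs⟩ := exists_isLeast_setOf_le_sum_mult hF hN hub hn
  rw [hs.csInf_eq]
  exact ⟨fun h => le_trans hs.1 (monotone_of_sum_mult hF hN h), fun h => hs.2 h⟩

theorem mult_sInf_setOf_le_sum_mult_ne_zero (hF : ∀ T t, t ∈ F T ↔ μ t ≠ 0 ∧ t ≤ T)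
    (hN : ∀ T, N T = ∑ t ∈ F T, μ t) (hub : ∀ n, ∃ T, n ≤ N T) {n : ℕ} (hn : 1 ≤ n) :
    μ (sInf {T | n ≤ N T}) ≠ 0 := by
  obtain ⟨s, hμ, hs⟩ := exists_isLeast_setOf_le_sum_mult hF hN hub hn
  rwa [hs.csInf_eq]

/-- Each point occurs in the enumeration as often as its multiplicity. -/
theorem card_filter_sInf_setOf_le_sum_mult_eq (hF : ∀ T t, t ∈ F T ↔ μ t ≠ 0 ∧ t ≤ T)
    (hN : ∀ T, N T = ∑ t ∈ F T, μ t) (hub : ∀ n, ∃ T, n ≤ N T) {t T : ℝ} (ht : t ∈ F T) :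
    ((Finset.Icc 1 (N T)).filter fun k => sInf {T | k ≤ N T} = t).card = μ t := by
  classical
  have hmono := monotone_of_sum_mult hF hN
  have htT := (hF T t).1 ht
  have htt : t ∈ F t := (hF t t).2 ⟨htT.1, le_rfl⟩
  -- t' is the point just before t, or t - 1 if there is none; the indices enumerating t are then
  -- exactly those in (N t', N t].
  obtain ⟨t', ht't, ht'⟩ : ∃ t' < t, ∀ s ∈ F t, s ≠ t → s ≤ t' := by
    by_cases hne : ((F t).erase t).Nonempty
    · refine ⟨((F t).erase t).max' hne, ?_, fun s hs hst =>
        Finset.le_max' _ _ (Finset.mem_erase.2 ⟨hst, hs⟩)⟩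
      have := Finset.max'_mem _ hne
      rw [Finset.mem_erase] at this
      exact lt_of_le_of_ne ((hF _ _).1 this.2).2 this.1
    · rw [Finset.not_nonempty_iff_eq_empty] at hne
      refine ⟨t - 1, by linarith, fun s hs hst => ?_⟩
      have : s ∈ (F t).erase t := Finset.mem_erase.2 ⟨hst, hs⟩
      simp [hne] at this
  have hFt : (F t).erase t = F t' := by
    ext s
    rw [Finset.mem_erase, hF, hF]
    constructor
    · rintro ⟨h1, h2, h3⟩
      exact ⟨h2, ht' s ((hF _ _).2 ⟨h2, h3⟩) h1⟩
    · rintro ⟨h1, h2⟩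
      exact ⟨(lt_of_le_of_lt h2 ht't).ne, h1, h2.trans ht't.le⟩
  have hNt : N t' + μ t = N t := by
    rw [hN t', hN t, ← hFt, Finset.sum_erase_add _ _ htt]
  have hset : ((Finset.Icc 1 (N T)).filter fun k => sInf {T | k ≤ N T} = t)
      = Finset.Ioc (N t') (N t) := by
    ext k
    simp only [Finset.mem_filter, Finset.mem_Icc, Finset.mem_Ioc]
    constructor
    · rintro ⟨⟨hk, -⟩, hkt⟩
      have h := fun S => sInf_setOf_le_sum_mult_le_iff hF hN hub hk S
      rw [hkt] at h
      exact ⟨not_le.1 fun hle => absurd ((h t').2 hle) (not_le.2 ht't), (h t).1 le_rfl⟩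
    · rintro ⟨h1, h2⟩
      have hk : 1 ≤ k := by omega
      have h := fun S => sInf_setOf_le_sum_mult_le_iff hF hN hub hk S
      refine ⟨⟨hk, h2.trans (hmono htT.2)⟩, ?_⟩
      by_contra hne
      have h3 := ht' _ ((hF _ _).2
        ⟨mult_sInf_setOf_le_sum_mult_ne_zero hF hN hub hk, (h t).2 h2⟩) hne
      exact absurd ((h t').1 h3) (not_le.2 h1)
  rw [hset, Nat.card_Ioc]
  omega

theorem exists_sInf_setOf_le_sum_mult_eq (hF : ∀ T t, t ∈ F T ↔ μ t ≠ 0 ∧ t ≤ T)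
    (hN : ∀ T, N T = ∑ t ∈ F T, μ t) (hub : ∀ n, ∃ T, n ≤ N T) {t : ℝ} (ht : μ t ≠ 0) :
    ∃ n, 1 ≤ n ∧ sInf {T | n ≤ N T} = t := by
  have h := card_filter_sInf_setOf_le_sum_mult_eq hF hN hub ((hF t t).2 ⟨ht, le_rfl⟩)
  have hpos := Finset.card_pos.1 (h.symm ▸ Nat.pos_of_ne_zero ht)
  obtain ⟨n, hn⟩ := hpos
  rw [Finset.mem_filter, Finset.mem_Icc] at hn
  exact ⟨n, hn.1.1, hn.2⟩

/-- Grouping the indices by the point they enumerate converts index sums into the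
multiplicity-weighted sums that come from partial fractions. -/
theorem sum_sInf_setOf_le_sum_mult (hF : ∀ T t, t ∈ F T ↔ μ t ≠ 0 ∧ t ≤ T)
    (hN : ∀ T, N T = ∑ t ∈ F T, μ t) (hub : ∀ n, ∃ T, n ≤ N T) (φ : ℝ → ℝ) (T : ℝ) :
    ∑ k ∈ Finset.Icc 1 (N T), φ (sInf {T | k ≤ N T}) = ∑ t ∈ F T, μ t * φ t := by
  classical
  have hmaps : ∀ k ∈ Finset.Icc 1 (N T), sInf {T | k ≤ N T} ∈ F T := by
    intro k hk
    rw [Finset.mem_Icc] at hk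
    exact (hF _ _).2 ⟨mult_sInf_setOf_le_sum_mult_ne_zero hF hN hub hk.1,
      (sInf_setOf_le_sum_mult_le_iff hF hN hub hk.1 T).2 hk.2⟩
  rw [← Finset.sum_fiberwise_of_maps_to hmaps]
  refine Finset.sum_congr rfl fun t ht => ?_
  rw [Finset.sum_congr rfl (fun k hk => by rw [(Finset.mem_filter.1 hk).2] :
      ∀ k ∈ (Finset.Icc 1 (N T)).filter (fun k => sInf {T | k ≤ N T} = t),
        φ (sInf {T | k ≤ N T}) = φ t), Finset.sum_const,
    card_filter_sInf_setOf_le_sum_mult_eq hF hN hub ht, nsmul_eq_mul]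

theorem exists_le_sum_mult_of_infinite (hF : ∀ T t, t ∈ F T ↔ μ t ≠ 0 ∧ t ≤ T)
    (hN : ∀ T, N T = ∑ t ∈ F T, μ t) (hinf : {t | μ t ≠ 0}.Infinite) (n : ℕ) :
    ∃ T, n ≤ N T := by
  obtain ⟨S, hS, hcard⟩ := hinf.exists_subset_card_eq n
  obtain ⟨T, hT⟩ := S.bddAbove
  refine ⟨T, ?_⟩
  rw [hN, ← hcard]
  calc S.card = ∑ t ∈ S, 1 := by simp
    _ ≤ ∑ t ∈ S, μ t := Finset.sum_le_sum fun t ht => Nat.one_le_iff_ne_zero.2 (hS ht)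
    _ ≤ ∑ t ∈ F T, μ t := Finset.sum_le_sum_of_subset fun t ht =>
        (hF _ _).2 ⟨hS ht, hT ht⟩

end Enumeration

/-! ### The ξ-function: zeros, multiplicities, factorization. -/

/-- The entire function `s (s - 1) Λ(s)`, twice the Riemann `ξ`-function. -/
def riemannXi (s : ℂ) : ℂ := s * (s - 1) * completedRiemannZeta₀ s + 1

theorem differentiable_riemannXi : Differentiable ℂ riemannXi := by
  have := differentiable_completedZeta₀
  unfold riemannXi
  fun_prop

theorem riemannXi_one_sub (s : ℂ) : riemannXi (1 - s) = riemannXi s := by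
  rw [riemannXi, riemannXi, completedRiemannZeta₀_one_sub]
  ring

theorem riemannXi_eq {s : ℂ} (hs : 0 < s.re) (hs1 : s ≠ 1) :
    riemannXi s = s * (s - 1) * (Complex.Gammaℝ s * riemannZeta s) := by
  have hs0 : s ≠ 0 := by rintro rfl; simp at hs
  have h1 : 1 - s ≠ 0 := sub_ne_zero.2 hs1.symm
  rw [riemannZeta_def_of_ne_zero hs0, mul_div_cancel₀ _ (Complex.Gammaℝ_ne_zero_of_re_pos hs),
    completedRiemannZeta_eq, riemannXi]
  field_simp
  ring

theorem riemannXi_ne_zero_of_one_le_re {s : ℂ} (hs : 1 ≤ s.re) : riemannXi s ≠ 0 := by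
  rcases eq_or_ne s 1 with rfl | h
  · simp [riemannXi]
  · have hs0 : s ≠ 0 := by rintro rfl; norm_num at hs
    rw [riemannXi_eq (by linarith) h]
    exact mul_ne_zero (mul_ne_zero hs0 (sub_ne_zero.2 h))
      (mul_ne_zero (Complex.Gammaℝ_ne_zero_of_re_pos (by linarith))
        (riemannZeta_ne_zero_of_one_le_re hs))

/-- The zeros of `riemannXi` are the non-trivial zeros of the zeta function. -/
theorem riemannXi_eq_zero_iff {s : ℂ} :
    riemannXi s = 0 ↔ riemannZeta s = 0 ∧ 0 < s.re ∧ s.re < 1 := by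
  constructor
  · intro h
    have h1 : s.re < 1 := not_le.1 fun h1 => riemannXi_ne_zero_of_one_le_re h1 h
    have h0 : 0 < s.re := by
      refine not_le.1 fun h0 => riemannXi_ne_zero_of_one_le_re (s := 1 - s) ?_ ?_
      · simp [h0]
      · rw [riemannXi_one_sub, h]
    refine ⟨?_, h0, h1⟩
    have hs1 : s ≠ 1 := by rintro rfl; simp at h1
    have hs0 : s ≠ 0 := by rintro rfl; simp at h0
    rw [riemannXi_eq h0 hs1] at h
    simpa [hs0, sub_ne_zero.2 hs1, Complex.Gammaℝ_ne_zero_of_re_pos h0] using h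
  · rintro ⟨h, h0, h1⟩
    have hs1 : s ≠ 1 := by rintro rfl; simp at h1
    rw [riemannXi_eq h0 hs1, h]
    simp

/-- Ensures that 1/2 + it and 1/2 - it carry the same weight in the sum over zeros. -/
theorem analyticOrderNatAt_riemannXi_one_sub (s : ℂ) :
    analyticOrderNatAt riemannXi (1 - s) = analyticOrderNatAt riemannXi s := by
  have h1 : analyticOrderAt (riemannXi ∘ fun z => 1 - z) s = analyticOrderAt riemannXi (1 - s) := by
    have hd : HasDerivAt (fun z : ℂ => 1 - z) (-1) s := by
      simpa using (hasDerivAt_id s).const_sub 1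
    refine analyticOrderAt_comp_of_deriv_ne_zero (by fun_prop) ?_
    rw [hd.deriv]
    norm_num
  have h2 : riemannXi ∘ (fun z => 1 - z) = riemannXi := funext riemannXi_one_sub
  rw [h2] at h1
  simp [analyticOrderNatAt, h1]

theorem analyticAt_Gammaℝ {s : ℂ} (hs : 0 < s.re) : AnalyticAt ℂ Complex.Gammaℝ s := by
  have h : ∀ᶠ z : ℂ in 𝓝 s, 0 < z.re :=
    Complex.continuous_re.continuousAt.eventually (lt_mem_nhds hs)
  rw [Complex.analyticAt_iff_eventually_differentiableAt]
  filter_upwards [h] with z hz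
  have h2 : DifferentiableAt ℂ Complex.Gamma (z / 2) := by
    refine Complex.differentiableAt_Gamma _ fun m hm => ?_
    have := congrArg Complex.re hm
    simp at this
    linarith [(Nat.cast_nonneg m : (0 : ℝ) ≤ m)]
  have hπ0 : (Real.pi : ℂ) ≠ 0 := by exact_mod_cast Real.pi_ne_zero
  have h3 : Complex.Gammaℝ = fun s => (Real.pi : ℂ) ^ (-s / 2) * Complex.Gamma (s / 2) :=
    funext Complex.Gammaℝ_def
  rw [h3]
  exact (DifferentiableAt.const_cpow (by fun_prop) (Or.inl hπ0)).mul (h2.comp z (by fun_prop))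

theorem analyticAt_riemannZeta {s : ℂ} (hs : s ≠ 1) : AnalyticAt ℂ riemannZeta s := by
  rw [Complex.analyticAt_iff_eventually_differentiableAt]
  filter_upwards [isOpen_ne.mem_nhds hs] with z hz using differentiableAt_riemannZeta hz

theorem eventually_riemannXi_eq {s : ℂ} (hs : 0 < s.re) (hs1 : s ≠ 1) :
    riemannXi =ᶠ[𝓝 s] fun s => s * (s - 1) * (Complex.Gammaℝ s * riemannZeta s) := by
  filter_upwards [Complex.continuous_re.continuousAt.eventually (lt_mem_nhds hs),
    isOpen_ne.mem_nhds hs1] with z hz hz1 using riemannXi_eq hz hz1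

theorem analyticOrderNatAt_riemannXi {s : ℂ} (hs : 0 < s.re) (hs1 : s ≠ 1) :
    analyticOrderNatAt riemannXi s = analyticOrderNatAt riemannZeta s := by
  have hs0 : s ≠ 0 := by rintro rfl; simp at hs
  have hA : AnalyticAt ℂ (fun s => s * (s - 1) * Complex.Gammaℝ s) s :=
    AnalyticAt.mul (by fun_prop) (analyticAt_Gammaℝ hs)
  have hA0 : s * (s - 1) * Complex.Gammaℝ s ≠ 0 :=
    mul_ne_zero (mul_ne_zero hs0 (sub_ne_zero.2 hs1)) (Complex.Gammaℝ_ne_zero_of_re_pos hs)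
  have h1 : riemannXi =ᶠ[𝓝 s] (fun s => s * (s - 1) * Complex.Gammaℝ s) * riemannZeta := by
    refine (eventually_riemannXi_eq hs hs1).trans (Eventually.of_forall fun z => ?_)
    simp only [Pi.mul_apply]
    ring
  have h2 : analyticOrderAt riemannXi s = analyticOrderAt riemannZeta s := by
    rw [analyticOrderAt_congr h1, analyticOrderAt_mul hA (analyticAt_riemannZeta hs1),
      hA.analyticOrderAt_eq_zero.2 hA0, zero_add]
  simp [analyticOrderNatAt, h2]

/-- At s = 1/2 and k = 2m - 1 these four summands become the terms of `vorosExpression`. -/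
theorem iteratedDeriv_logDeriv_riemannXi {s : ℂ} (hs : 0 < s.re) (hs1 : s ≠ 1)
    (hζ : riemannZeta s ≠ 0) (k : ℕ) :
    iteratedDeriv k (logDeriv riemannXi) s
      = (-1) ^ k * k.factorial * (s ^ (k + 1))⁻¹ + (-1) ^ k * k.factorial * ((s - 1) ^ (k + 1))⁻¹
        + (iteratedDeriv k (logDeriv Complex.Gammaℝ) s
          + iteratedDeriv k (logDeriv riemannZeta) s) := by
  have hs0 : s ≠ 0 := by rintro rfl; simp at hs
  have hlog : logDeriv riemannXi
      =ᶠ[𝓝 s] logDeriv fun s => s * (s - 1) * (Complex.Gammaℝ s * riemannZeta s) := by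
    filter_upwards [(eventually_riemannXi_eq hs hs1).eventually_nhds] with z hz
    rw [logDeriv_apply, logDeriv_apply, Filter.EventuallyEq.deriv_eq hz, hz.self_of_nhds]
  have hΓ0 := Complex.Gammaℝ_ne_zero_of_re_pos hs
  rw [hlog.iteratedDeriv_eq k, iteratedDeriv_logDeriv_mul (f := fun s => s * (s - 1))
      (g := fun s => Complex.Gammaℝ s * riemannZeta s) (by fun_prop) ((analyticAt_Gammaℝ hs).mul (analyticAt_riemannZeta hs1))
      (mul_ne_zero hs0 (sub_ne_zero.2 hs1)) (mul_ne_zero hΓ0 hζ),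
    iteratedDeriv_logDeriv_mul (f := fun s => s) (g := fun s => s - 1) (by fun_prop) (by fun_prop) hs0
      (sub_ne_zero.2 hs1),
    iteratedDeriv_logDeriv_mul (analyticAt_Gammaℝ hs) (analyticAt_riemannZeta hs1) hΓ0 hζ,
    iteratedDeriv_logDeriv_sub]
  have := iteratedDeriv_logDeriv_sub 0 s k
  simp only [sub_zero] at this
  rw [this]

/-! ### Growth of the ξ-function. -/

-- The Mellin integral defining `completedRiemannZeta₀` converges for every exponent, and for 0 ≤ Re
-- w ≤ 2 its kernel satisfies |t^(w-1)| ≤ t^(-1) + t. The integrals at w = 0 and w = 2 therefore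
-- dominate all others.
open MeasureTheory in
theorem exists_norm_completedRiemannZeta₀_le_of_re_mem_Icc :
    ∃ B, ∀ s : ℂ, 0 ≤ s.re → s.re ≤ 4 → ‖completedRiemannZeta₀ s‖ ≤ B := by
  set P := HurwitzZeta.hurwitzEvenFEPair 0
  have hconv : ∀ s, MellinConvergent P.f_modif s :=
    fun s => (P.isStrongFEPair_toStrongFEPair.hasMellin s).1
  have hb : ∀ w : ℂ, 0 ≤ w.re → w.re ≤ 2 → ‖mellin P.f_modif w‖
      ≤ ∫ t in Set.Ioi (0 : ℝ), (‖(t : ℂ) ^ ((0 : ℂ) - 1) • P.f_modif t‖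
        + ‖(t : ℂ) ^ ((2 : ℂ) - 1) • P.f_modif t‖) := by
    intro w hw0 hw2
    rw [mellin]
    refine (norm_integral_le_integral_norm _).trans ?_
    refine setIntegral_mono_on (hconv w).norm ((hconv 0).norm.add (hconv 2).norm)
      measurableSet_Ioi fun t ht => ?_
    have ht : 0 < t := ht
    simp only [norm_smul]
    rw [← add_mul]
    gcongr
    rw [Complex.norm_cpow_eq_rpow_re_of_pos ht, Complex.norm_cpow_eq_rpow_re_of_pos ht,
      Complex.norm_cpow_eq_rpow_re_of_pos ht]
    simp only [Complex.sub_re, Complex.one_re, Complex.zero_re, Complex.re_ofNat]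
    rcases le_total 1 t with h | h
    · exact (Real.rpow_le_rpow_of_exponent_le h (by linarith)).trans
        (le_add_of_nonneg_left (Real.rpow_nonneg ht.le _))
    · exact (Real.rpow_le_rpow_of_exponent_ge ht h (by linarith)).trans
        (le_add_of_nonneg_right (Real.rpow_nonneg ht.le _))
  refine ⟨(∫ t in Set.Ioi (0 : ℝ), (‖(t : ℂ) ^ ((0 : ℂ) - 1) • P.f_modif t‖
        + ‖(t : ℂ) ^ ((2 : ℂ) - 1) • P.f_modif t‖)) / 2, fun s h0 h4 => ?_⟩
  have h1 : completedRiemannZeta₀ s = mellin P.f_modif (s / 2) / 2 := rfl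
  rw [h1, norm_div, Complex.norm_ofNat]
  gcongr
  refine hb _ ?_ ?_
  · simp; linarith
  · simp; linarith

theorem exists_norm_riemannZeta_le_of_two_le_re : ∃ B, ∀ s : ℂ, 2 ≤ s.re → ‖riemannZeta s‖ ≤ B := by
  have hsum : Summable fun n : ℕ => 1 / ((n : ℝ) + 1) ^ (2 : ℝ) := by
    have := (summable_nat_add_iff 1).2 (Real.summable_one_div_nat_rpow.2 one_lt_two)
    exact_mod_cast this
  refine ⟨∑' n : ℕ, 1 / ((n : ℝ) + 1) ^ (2 : ℝ), fun s hs => ?_⟩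
  rw [zeta_eq_tsum_one_div_nat_add_one_cpow (by linarith)]
  refine tsum_of_norm_bounded hsum.hasSum fun n => ?_
  have h1 : ((n : ℂ) + 1) = (((n : ℝ) + 1 : ℝ) : ℂ) := by push_cast; ring
  have h2 : (1 : ℝ) ≤ (n : ℝ) + 1 := by linarith [(Nat.cast_nonneg n : (0 : ℝ) ≤ n)]
  rw [norm_div, norm_one, h1, Complex.norm_cpow_eq_rpow_re_of_pos (by linarith)]
  gcongr

/-- The strip 0 ≤ Re s ≤ 4 is bounded by the Mellin integral, Re s ≥ 4 by crude bounds on Γ and ζ,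
and Re s ≤ 0 is reflected by the functional equation, which costs the shift from R to R + 1. -/
theorem exists_norm_completedRiemannZeta₀_le :
    ∃ B > 0, ∀ R : ℝ, 1 ≤ R → ∀ s : ℂ, ‖s‖ ≤ R →
      ‖completedRiemannZeta₀ s‖ ≤ B * Real.exp ((R + 2) * Real.log (R + 2)) := by
  obtain ⟨B₁, hB₁⟩ := exists_norm_completedRiemannZeta₀_le_of_re_mem_Icc
  obtain ⟨B₂, hB₂⟩ := exists_norm_riemannZeta_le_of_two_le_re
  have hB₁0 : 0 ≤ B₁ := (norm_nonneg _).trans (hB₁ 0 (by simp) (by simp))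
  have hB₂0 : 0 ≤ B₂ := (norm_nonneg _).trans (hB₂ 2 (by simp))
  have hright : ∀ R : ℝ, 1 ≤ R → ∀ s : ℂ, ‖s‖ ≤ R → 0 ≤ s.re →
      ‖completedRiemannZeta₀ s‖ ≤ (B₁ + B₂ + 2) * Real.exp ((R + 1) * Real.log (R + 1)) := by
    intro R hR s hs hs0
    have hE : 1 ≤ Real.exp ((R + 1) * Real.log (R + 1)) :=
      Real.one_le_exp (mul_nonneg (by linarith) (Real.log_nonneg (by linarith)))
    rcases le_total s.re 4 with h4 | h4
    · calc ‖completedRiemannZeta₀ s‖ ≤ B₁ := hB₁ s hs0 h4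
        _ ≤ (B₁ + B₂ + 2) * 1 := by linarith
        _ ≤ _ := by gcongr
    · have hre := (Complex.re_le_norm s).trans hs
      have hs1 : s ≠ 1 := by rintro rfl; norm_num at h4
      have hsne : s ≠ 0 := by rintro rfl; norm_num at h4
      have h1 : completedRiemannZeta₀ s
          = Complex.Gammaℝ s * riemannZeta s + 1 / s + 1 / (1 - s) := by
        rw [riemannZeta_def_of_ne_zero hsne,
          mul_div_cancel₀ _ (Complex.Gammaℝ_ne_zero_of_re_pos (by linarith)),
          completedRiemannZeta_eq]
        ring
      have hΓ : ‖Complex.Gammaℝ s‖ ≤ Real.exp ((R + 1) * Real.log (R + 1)) := by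
        rw [Complex.Gammaℝ_def, norm_mul]
        have ha : ‖(Real.pi : ℂ) ^ (-s / 2)‖ ≤ 1 := by
          rw [Complex.norm_cpow_eq_rpow_re_of_pos Real.pi_pos]
          refine Real.rpow_le_one_of_one_le_of_nonpos (by linarith [Real.pi_gt_three]) ?_
          simp
          linarith
        have hn : R ≤ (⌈R⌉₊ : ℝ) := Nat.le_ceil R
        have hn1 : (⌈R⌉₊ : ℝ) ≤ R + 1 := (Nat.ceil_lt_add_one (by linarith)).le
        have hre2 : (s / 2).re = s.re / 2 := by simp
        have hb : ‖Complex.Gamma (s / 2)‖ ≤ Real.exp ((R + 1) * Real.log (R + 1)) := by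
          calc ‖Complex.Gamma (s / 2)‖ ≤ Real.Gamma (s / 2).re :=
                Complex.norm_Gamma_le_Gamma_re (by rw [hre2]; linarith)
            _ ≤ Real.exp (⌈R⌉₊ * Real.log ⌈R⌉₊) :=
                Real.Gamma_le_exp_mul_log (by rw [hre2]; linarith) (by rw [hre2]; linarith)
                  (Nat.one_le_ceil_iff.2 (by linarith))
            _ ≤ _ := by
                have h0 : (0 : ℝ) < ⌈R⌉₊ := by linarith
                have : 0 ≤ Real.log ⌈R⌉₊ := Real.log_nonneg (by linarith)
                gcongr
        calc _ ≤ 1 * Real.exp ((R + 1) * Real.log (R + 1)) := by gcongr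
          _ = _ := one_mul _
      have hinv : ∀ z : ℂ, 1 ≤ ‖z‖ → ‖1 / z‖ ≤ 1 := by
        intro z hz
        rw [norm_div, norm_one, div_le_one (by linarith)]
        exact hz
      have hi1 := hinv s (by linarith [Complex.re_le_norm s])
      have hi2 := hinv (1 - s) (by
        have := Complex.re_le_norm (-(1 - s))
        rw [norm_neg] at this
        simp at this
        linarith)
      rw [h1]
      calc _ ≤ ‖Complex.Gammaℝ s‖ * ‖riemannZeta s‖ + ‖1 / s‖ + ‖1 / (1 - s)‖ := by
            rw [← norm_mul]; exact norm_add₃_le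
        _ ≤ Real.exp ((R + 1) * Real.log (R + 1)) * B₂ + 1 + 1 := by
            gcongr
            exact hB₂ s (by linarith)
        _ ≤ _ := by nlinarith
  refine ⟨B₁ + B₂ + 2, by linarith, fun R hR s hs => ?_⟩
  rcases le_total 0 s.re with h | h
  · refine (hright R hR s hs h).trans ?_
    have : 0 ≤ Real.log (R + 1) := Real.log_nonneg (by linarith)
    gcongr <;> linarith
  · have h1 : ‖1 - s‖ ≤ R + 1 := by
      have := norm_sub_le (1 : ℂ) s
      rw [norm_one] at this
      linarith
    have := hright (R + 1) (by linarith) (1 - s) h1 (by simp; linarith)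
    rw [completedRiemannZeta₀_one_sub, add_assoc R, one_add_one_eq_two] at this
    exact this

open Metric in
/-- `riemannXi` is of order one: its logarithm grows at most like `R log R`. -/
theorem exists_norm_riemannXi_le :
    ∃ M : ℝ → ℝ, (∀ R, 0 < R → ∀ z ∈ closedBall (1 / 2 : ℂ) R, ‖riemannXi z‖ ≤ Real.exp (M R)) ∧
      Tendsto (fun R => M R / R ^ 2) atTop (𝓝 0) := by
  obtain ⟨B, hB, hbound⟩ := exists_norm_completedRiemannZeta₀_le
  refine ⟨fun R => Real.log (1 + B) + (R + 5) * Real.log (R + 3), fun R hR z hz => ?_, ?_⟩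
  · have hz' : ‖z‖ ≤ R + 1 := by
      have h1 : ‖z - 1 / 2‖ ≤ R := by simpa [dist_eq_norm] using hz
      have h2 : ‖z‖ ≤ ‖z - 1 / 2‖ + ‖(1 / 2 : ℂ)‖ := by
        simpa using norm_add_le (z - 1 / 2) (1 / 2)
      have h3 : ‖(1 / 2 : ℂ)‖ = 1 / 2 := by simp
      linarith
    have h1 := hbound (R + 1) (by linarith) z hz'
    rw [show R + 1 + 2 = R + 3 by ring] at h1
    set E := Real.exp ((R + 3) * Real.log (R + 3)) with hE
    have hE1 : 1 ≤ E :=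
      Real.one_le_exp (mul_nonneg (by linarith) (Real.log_nonneg (by linarith)))
    have hz1 : ‖z - 1‖ ≤ R + 2 := by
      have := norm_sub_le z 1
      rw [norm_one] at this
      linarith
    have hexp : Real.exp (Real.log (1 + B) + (R + 5) * Real.log (R + 3))
        = (1 + B) * ((R + 3) ^ 2 * E) := by
      rw [Real.exp_add, Real.exp_log (by linarith), hE, show (R + 5) * Real.log (R + 3)
        = Real.log (R + 3) * 2 + (R + 3) * Real.log (R + 3) by ring, Real.exp_add, Real.exp_mul,
        Real.exp_log (by linarith)]
      norm_num
    rw [hexp, riemannXi]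
    calc ‖z * (z - 1) * completedRiemannZeta₀ z + 1‖
        ≤ ‖z‖ * ‖z - 1‖ * ‖completedRiemannZeta₀ z‖ + 1 := by
          simpa using norm_add_le (z * (z - 1) * completedRiemannZeta₀ z) 1
      _ ≤ (R + 3) * (R + 3) * (B * E) + 1 := by gcongr <;> linarith
      _ ≤ _ := by
          have h2 : 1 ≤ (R + 3) ^ 2 * E := by
            have : (1 : ℝ) ≤ (R + 3) ^ 2 := by nlinarith
            nlinarith
          nlinarith
  · have h1 : Tendsto (fun R : ℝ => Real.log (1 + B) / R ^ 2) atTop (𝓝 0) :=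
      tendsto_const_nhds.div_atTop (tendsto_pow_atTop two_ne_zero)
    have hr : ∀ a : ℝ, Tendsto (fun R : ℝ => 1 + a / R) atTop (𝓝 1) := fun a => by
      simpa using (tendsto_const_nhds (x := (1 : ℝ))).add
        (tendsto_const_nhds (x := a).div_atTop tendsto_id)
    have h2 : Tendsto (fun R : ℝ => Real.log (R + 3) / (R + 3)) atTop (𝓝 0) :=
      tendsto_log_div_self_atTop.comp (tendsto_atTop_add_const_right _ 3 tendsto_id)
    have h3 := h1.add (((hr 5).mul h2).mul (hr 3))
    simp only [mul_zero, zero_mul, add_zero] at h3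
    refine h3.congr' ?_
    filter_upwards [eventually_gt_atTop 0] with R hR
    field_simp

/-! ### Nonvanishing at the centre 1/2. -/

-- The kernel minus 1 is twice the sum of q^(n²), n ≥ 1, with q = exp(-πx). Replacing n² by n gives
-- 2q/(1-q) ≤ 2/(πx). The weaker exponent -1/2 is chosen to cancel the factor t^(-1/2) of the theta
-- inversion below.
open Real in
theorem cosKernel_zero_sub_one_mem_Icc {x : ℝ} (hx : 1 ≤ x) :
    HurwitzZeta.cosKernel 0 x - 1 ∈ Set.Icc 0 (2 / π * x ^ (-1 / 2 : ℝ)) := by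
  have hx0 : 0 < x := by linarith
  have hsum := HurwitzZeta.hasSum_nat_cosKernel₀ 0 hx0
  simp only [mul_zero, zero_mul, Real.cos_zero, mul_one, QuotientAddGroup.mk_zero] at hsum
  set q := rexp (-π * x) with hq
  have hq0 : 0 < q := Real.exp_pos _
  have hq1 : q < 1 := by
    rw [hq, ← Real.exp_zero]
    exact Real.exp_lt_exp.2 (by nlinarith [Real.pi_pos])
  have hgeo : HasSum (fun n : ℕ => 2 * q * q ^ n) (2 * q * (1 - q)⁻¹) :=
    (hasSum_geometric_of_lt_one hq0.le hq1).mul_left _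
  refine ⟨hsum.nonneg fun n => by positivity, ?_⟩
  calc HurwitzZeta.cosKernel 0 x - 1 ≤ 2 * q * (1 - q)⁻¹ := by
        refine hasSum_le (fun n => ?_) hsum hgeo
        rw [mul_assoc 2 q, ← pow_succ', hq, ← Real.exp_nat_mul]
        refine mul_le_mul_of_nonneg_left (Real.exp_le_exp.2 ?_) zero_le_two
        push_cast
        have : (0 : ℝ) ≤ n := Nat.cast_nonneg n
        have h2 : ((n : ℝ) + 1) * (π * x) ≤ ((n : ℝ) + 1) ^ 2 * (π * x) := by
          have := mul_pos Real.pi_pos hx0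
          gcongr
          nlinarith
        linarith
    _ ≤ 2 / (π * x) := by
        have h1 : π * x + 1 ≤ q⁻¹ := by
          rw [hq, ← Real.exp_neg]
          simpa using Real.add_one_le_exp (π * x)
        have h2 : 0 < π * x := mul_pos Real.pi_pos hx0
        rw [← div_eq_mul_inv, div_le_div_iff₀ (by linarith) h2]
        have h3 : (π * x + 1) * q ≤ 1 := by
          calc _ ≤ q⁻¹ * q := by gcongr
            _ = 1 := inv_mul_cancel₀ hq0.ne'
        linarith
    _ ≤ 2 / π * x ^ (-1 / 2 : ℝ) := by
        rw [← div_div, div_eq_mul_inv (2 / π), ← Real.rpow_neg_one]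
        gcongr
        norm_num

-- Splitting the Mellin integral at t = 1 and inverting the theta function on (0, 1], each half is
-- at most 8/π. After the outer factor 1/2 the total is at most 8/π, which is below 4 since π > 3.
open Real MeasureTheory in
theorem norm_completedRiemannZeta₀_one_half_lt : ‖completedRiemannZeta₀ (1 / 2)‖ < 4 := by
  set P := HurwitzZeta.hurwitzEvenFEPair 0 with hP
  have hint : IntegrableOn (fun t : ℝ => ‖(t : ℂ) ^ ((1 / 4 : ℂ) - 1) • P.f_modif t‖) (Set.Ioi 0) :=
    (P.isStrongFEPair_toStrongFEPair.hasMellin (1 / 4)).1.norm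
  have hpow : ∀ t : ℝ, 0 < t → ‖(t : ℂ) ^ ((1 / 4 : ℂ) - 1)‖ = t ^ (-3 / 4 : ℝ) := by
    intro t ht
    rw [Complex.norm_cpow_eq_rpow_re_of_pos ht]
    congr 1
    simp
    norm_num
  have hgt : ∀ t ∈ Set.Ioi (1 : ℝ),
      ‖(t : ℂ) ^ ((1 / 4 : ℂ) - 1) • P.f_modif t‖ ≤ 2 / π * t ^ (-5 / 4 : ℝ) := by
    intro t ht
    have ht1 : 1 < t := ht
    have h1 : P.f_modif t = ((HurwitzZeta.cosKernel 0 t - 1 : ℝ) : ℂ) := by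
      rw [WeakFEPair.f_modif, Pi.add_apply, Set.indicator_of_mem ht,
        Set.indicator_of_notMem (fun h => absurd h.2 ht1.not_gt), add_zero]
      simp [hP, HurwitzZeta.hurwitzEvenFEPair, HurwitzZeta.evenKernel_eq_cosKernel_of_zero]
    have h2 := cosKernel_zero_sub_one_mem_Icc ht1.le
    rw [norm_smul, hpow t (by linarith), h1, Complex.norm_real, Real.norm_eq_abs, abs_of_nonneg h2.1]
    calc _ ≤ t ^ (-3 / 4 : ℝ) * (2 / π * t ^ (-1 / 2 : ℝ)) := by
          gcongr
          exact h2.2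
      _ = 2 / π * (t ^ (-3 / 4 : ℝ) * t ^ (-1 / 2 : ℝ)) := by ring
      _ = _ := by rw [← Real.rpow_add (by linarith)]; norm_num
  have hle : ∀ t ∈ Set.Ioc (0 : ℝ) 1,
      ‖(t : ℂ) ^ ((1 / 4 : ℂ) - 1) • P.f_modif t‖ ≤ 2 / π * t ^ (-3 / 4 : ℝ) := by
    intro t ht
    have ht0 : 0 < t := ht.1
    rw [norm_smul, hpow t ht0, mul_comm]
    refine mul_le_mul_of_nonneg_right ?_ (Real.rpow_nonneg ht0.le _)
    rcases eq_or_lt_of_le ht.2 with rfl | ht1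
    · have : P.f_modif 1 = 0 := by simp [WeakFEPair.f_modif]
      rw [this, norm_zero]
      positivity
    · have h1 : P.f_modif t
          = ((t ^ (-1 / 2 : ℝ) * (HurwitzZeta.cosKernel 0 (1 / t) - 1) : ℝ) : ℂ) := by
        rw [WeakFEPair.f_modif, Pi.add_apply, Set.indicator_of_mem (Set.mem_Ioo.2 ⟨ht0, ht1⟩),
          Set.indicator_of_notMem (by simpa using ht1.le), zero_add]
        simp only [hP, HurwitzZeta.hurwitzEvenFEPair, Function.comp_apply, one_mul, smul_eq_mul,
          mul_one, HurwitzZeta.evenKernel_functional_equation, one_div]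
        rw [show (-1 / 2 : ℝ) = -2⁻¹ by norm_num, Real.rpow_neg ht0.le]
        push_cast
        ring
      have h2 := cosKernel_zero_sub_one_mem_Icc (x := 1 / t) (by rw [le_div_iff₀ ht0]; linarith)
      rw [h1, Complex.norm_real, Real.norm_eq_abs,
        abs_of_nonneg (mul_nonneg (Real.rpow_nonneg ht0.le _) h2.1)]
      calc _ ≤ t ^ (-1 / 2 : ℝ) * (2 / π * (1 / t) ^ (-1 / 2 : ℝ)) := by
            gcongr
            exact h2.2
        _ = 2 / π * (t ^ (-1 / 2 : ℝ) * (1 / t) ^ (-1 / 2 : ℝ)) := by ring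
        _ = 2 / π := by
            rw [← Real.mul_rpow ht0.le (by positivity), mul_one_div_cancel ht0.ne', Real.one_rpow,
              mul_one]
  have hI1 : ∫ t in Set.Ioc (0 : ℝ) 1, 2 / π * t ^ (-3 / 4 : ℝ) = 2 / π * 4 := by
    rw [integral_const_mul, ← intervalIntegral.integral_of_le zero_le_one,
      integral_rpow (Or.inl (by norm_num))]
    norm_num
  have hI2 : ∫ t in Set.Ioi (1 : ℝ), 2 / π * t ^ (-5 / 4 : ℝ) = 2 / π * 4 := by
    rw [integral_const_mul, integral_Ioi_rpow_of_lt (by norm_num) one_pos]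
    norm_num
  have hm : ‖mellin P.f_modif (1 / 4)‖ ≤ 2 / π * 4 + 2 / π * 4 := by
    rw [mellin]
    refine (norm_integral_le_integral_norm _).trans ?_
    rw [← Set.Ioc_union_Ioi_eq_Ioi (zero_le_one' ℝ), setIntegral_union
      (Set.Ioc_disjoint_Ioi le_rfl) measurableSet_Ioi
      (hint.mono_set Set.Ioc_subset_Ioi_self) (hint.mono_set (Set.Ioi_subset_Ioi zero_le_one))]
    refine add_le_add (le_of_le_of_eq ?_ hI1) (le_of_le_of_eq ?_ hI2)
    · refine setIntegral_mono_on (hint.mono_set Set.Ioc_subset_Ioi_self) ?_ measurableSet_Ioc hle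
      refine Integrable.const_mul ?_ _
      rw [← IntegrableOn, ← intervalIntegrable_iff_integrableOn_Ioc_of_le zero_le_one]
      exact intervalIntegral.intervalIntegrable_rpow' (by norm_num)
    · exact setIntegral_mono_on (hint.mono_set (Set.Ioi_subset_Ioi zero_le_one))
        ((integrableOn_Ioi_rpow_of_lt (by norm_num) one_pos).const_mul _) measurableSet_Ioi hgt
  have h1 : completedRiemannZeta₀ (1 / 2) = mellin P.f_modif (1 / 2 / 2) / 2 := rfl
  rw [h1, show (1 / 2 / 2 : ℂ) = 1 / 4 by norm_num, norm_div, Complex.norm_ofNat]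
  have h2 : 2 / π * 4 + 2 / π * 4 < 8 := by
    have : 2 / π < 1 := by
      rw [div_lt_one Real.pi_pos]
      linarith [Real.pi_gt_three]
    linarith
  linarith

/-- Here s(s-1) = -1/4, so a zero would force the value 4 for `completedRiemannZeta₀ (1 / 2)`,
beyond the bound just proved. -/
theorem riemannXi_one_half_ne_zero : riemannXi (1 / 2) ≠ 0 := by
  intro h
  have h1 : completedRiemannZeta₀ (1 / 2) = 4 := by
    rw [riemannXi] at h
    linear_combination (-4) * h
  have h2 := norm_completedRiemannZeta₀_one_half_lt
  rw [h1] at h2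
  norm_num at h2

theorem riemannZeta_one_half_ne_zero : riemannZeta (1 / 2) ≠ 0 := fun h =>
  riemannXi_one_half_ne_zero (riemannXi_eq_zero_iff.2 ⟨h, by norm_num, by norm_num⟩)

/-! ### Infinitude of the zeros. -/

/-- An entire function of order less than two is a polynomial times the exponential of a linear
function if it has finitely many zeros. -/
theorem exists_norm_le_exp_of_finite_zeros {f : ℂ → ℂ} (hf : Differentiable ℂ f) {c : ℂ}
    (hc : f c ≠ 0) {M : ℝ → ℝ}
    (hM : ∀ R, 0 < R → ∀ z ∈ Metric.closedBall c R, ‖f z‖ ≤ Real.exp (M R))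
    (hMo : Tendsto (fun R => M R / R ^ 2) atTop (𝓝 0)) (hfin : {z | f z = 0}.Finite) :
    ∃ A B : ℝ, 0 < A ∧ ∀ z, ‖f z‖ ≤ A * Real.exp (B * ‖z - c‖) := by
  obtain ⟨g, hg, hfg, hg0⟩ := exists_eq_prod_sub_pow_mul hf hc hfin.toFinset
  have hne : ∀ z, g z ≠ 0 := fun z => hg0 z (by
    by_cases h : f z = 0
    · exact Or.inl (by simpa using h)
    · exact Or.inr h)
  have hE : ∀ k, 1 ≤ k → iteratedDeriv k (logDeriv g) c = 0 := by
    intro k hk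
    obtain ⟨R₀, hR₀⟩ := (hfin.image fun a => dist a c).bddAbove
    have hgc : 0 < ‖g c‖ := norm_pos_iff.2 (hne c)
    set R₁ := max R₀ 1
    -- The partial fraction theorem with no zeros at all kills the higher derivatives. The growth
    -- bound for g needs a disc containing every zero of f, hence the radius max R R₁.
    have hgrowth := tendsto_sum_zeros_iteratedDeriv_logDeriv hg (hne c)
      (M := fun R => Real.log ‖g c‖ + (M (3 * max R R₁) - Real.log ‖f c‖)) (Z := fun _ => ∅)
      (fun R hR z hz => by
        have h1 : 0 < max R R₁ := lt_max_of_lt_left hR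
        have h2 : ∀ a ∈ hfin.toFinset, dist a c ≤ max R R₁ := fun a ha =>
          (hR₀ ⟨a, by simpa using ha, rfl⟩).trans ((le_max_left _ _).trans (le_max_right _ _))
        have h3 : z ∈ Metric.ball c (3 * max R R₁) := by
          rw [Metric.mem_closedBall] at hz
          rw [Metric.mem_ball]
          linarith [le_max_left R R₁]
        rw [Real.exp_add, Real.exp_log hgc]
        exact norm_le_of_eq_prod_sub_pow_mul hg hc hfg h1 h2 (hM _ (by positivity)) h3)
      (by
        have h1 := hMo.comp (tendsto_id.const_mul_atTop (show (0 : ℝ) < 3 by norm_num))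
        have h2 : Tendsto (fun R : ℝ => (Real.log ‖g c‖ - Real.log ‖f c‖) / R ^ 2) atTop (𝓝 0) :=
          tendsto_const_nhds.div_atTop (tendsto_pow_atTop two_ne_zero)
        have h3 := h2.add (h1.const_mul 9)
        simp only [mul_zero, add_zero] at h3
        refine h3.congr' ?_
        filter_upwards [eventually_ge_atTop R₁, eventually_gt_atTop 0] with R hR hR0
        simp only [Function.comp_apply, id, max_eq_left hR]
        field_simp
        ring)
      (fun R a => by simp [hne a]) hk
    simp only [Finset.sum_empty] at hgrowth
    exact (tendsto_nhds_unique hgrowth tendsto_const_nhds)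
  have hlog : Differentiable ℂ (logDeriv g) := fun z =>
    ((hg.analyticAt z).logDeriv (hne z)).differentiableAt
  -- The Taylor coefficients of g'/g at c of positive index vanish, so g is the exponential of a
  -- linear function.
  obtain ⟨b, hb⟩ : ∃ b, ∀ z, logDeriv g z = b := by
    refine ⟨logDeriv g c, fun z => ?_⟩
    rw [← Complex.taylorSeries_eq_of_entire' c z hlog, tsum_eq_single 0]
    · simp
    · intro n hn
      rw [hE n (Nat.one_le_iff_ne_zero.2 hn)]
      simp
  have hgexp : ∀ z, g z = g c * Complex.exp (b * (z - c)) := by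
    intro z
    have hd : ∀ w, HasDerivAt (fun w => g w * Complex.exp (-(b * (w - c)))) 0 w := by
      intro w
      have h1 : deriv g w = b * g w := by
        have := hb w
        rw [logDeriv_apply, div_eq_iff (hne w)] at this
        exact this
      have h2 : HasDerivAt (fun w => -(b * (w - c))) (-(b * 1)) w :=
        (((hasDerivAt_id w).sub_const c).const_mul b).neg
      refine ((hg w).hasDerivAt.mul h2.cexp).congr_deriv ?_
      rw [h1]
      ring
    have := is_const_of_deriv_eq_zero (fun w => (hd w).differentiableAt) (fun w => (hd w).deriv) z c
    simp only [sub_self, mul_zero, neg_zero, Complex.exp_zero, mul_one] at this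
    rw [← this, mul_assoc, ← Complex.exp_add]
    simp
  have hexp_le : ∀ x : ℝ, x ≤ Real.exp x := fun x => by linarith [Real.add_one_le_exp x]
  refine ⟨Real.exp (∑ a ∈ hfin.toFinset, analyticOrderNatAt f a * ‖c - a‖) * ‖g c‖,
    (∑ a ∈ hfin.toFinset, (analyticOrderNatAt f a : ℝ)) + ‖b‖,
    mul_pos (Real.exp_pos _) (norm_pos_iff.2 (hne c)), fun z => ?_⟩
  have hprod : ‖∏ a ∈ hfin.toFinset, (z - a) ^ analyticOrderNatAt f a‖
      ≤ Real.exp (∑ a ∈ hfin.toFinset, analyticOrderNatAt f a * (‖z - c‖ + ‖c - a‖)) := by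
    rw [Real.exp_sum, norm_prod]
    refine Finset.prod_le_prod (fun _ _ => norm_nonneg _) fun a _ => ?_
    rw [norm_pow, Real.exp_nat_mul]
    gcongr
    exact (norm_sub_le_norm_sub_add_norm_sub z c a).trans (hexp_le _)
  have hgz : ‖g z‖ ≤ ‖g c‖ * Real.exp (‖b‖ * ‖z - c‖) := by
    rw [hgexp z, norm_mul, Complex.norm_exp]
    gcongr
    exact (Complex.re_le_norm _).trans (norm_mul _ _).le
  rw [hfg z, norm_mul]
  refine (mul_le_mul hprod hgz (norm_nonneg _) (Real.exp_pos _).le).trans (le_of_eq ?_)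
  simp only [mul_add, Finset.sum_add_distrib, ← Finset.sum_mul, add_mul, Real.exp_add]
  ring

theorem one_le_norm_riemannZeta_natCast {k : ℕ} (hk : 1 < k) : 1 ≤ ‖riemannZeta k‖ := by
  have hsum : Summable fun n : ℕ => 1 / (n : ℝ) ^ k := Real.summable_one_div_nat_pow.2 hk
  have h1 : riemannZeta k = ((∑' n : ℕ, 1 / (n : ℝ) ^ k : ℝ) : ℂ) := by
    rw [zeta_nat_eq_tsum_of_gt_one hk]
    push_cast
    rfl
  rw [h1, Complex.norm_real, Real.norm_eq_abs]
  refine le_trans ?_ (le_abs_self _)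
  have := hsum.le_tsum 1 fun n _ => by positivity
  simpa using this

/-- With finitely many zeros ξ would grow at most exponentially, whereas its Gamma factor makes it
grow factorially along the even integers. -/
theorem infinite_setOf_riemannXi_eq_zero : {z | riemannXi z = 0}.Infinite := by
  intro hfin
  obtain ⟨M, hM, hMo⟩ := exists_norm_riemannXi_le
  obtain ⟨A, B, hA, hAB⟩ := exists_norm_le_exp_of_finite_zeros differentiable_riemannXi
    riemannXi_one_half_ne_zero hM hMo hfin
  -- At s = 2(n+1) the lower bound is n!/π^(n+1) and the upper bound is A·exp(2|B|(n+1)), so n! ≤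
  -- A·K^(n+1) would hold for every n.
  set K : ℝ := Real.pi * Real.exp (2 * |B|) with hK
  have hK0 : 0 < K := mul_pos Real.pi_pos (Real.exp_pos _)
  have hlim := (FloorSemiring.tendsto_pow_div_factorial_atTop K).eventually
    (gt_mem_nhds (show (0 : ℝ) < 1 / (A * K) by positivity))
  obtain ⟨n, hn⟩ := hlim.exists
  have hlow : (n.factorial : ℝ) * (Real.pi ^ (n + 1))⁻¹ ≤ ‖riemannXi (((2 * (n + 1) : ℕ) : ℂ))‖ := by
    have hre : ((2 * (n + 1) : ℕ) : ℂ).re = 2 * ((n : ℝ) + 1) := by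
      rw [Complex.natCast_re]; push_cast; ring
    have hn0 : (0 : ℝ) ≤ n := Nat.cast_nonneg n
    have h1 : ((2 * (n + 1) : ℕ) : ℂ) ≠ 1 := by
      intro h
      have h2 := congrArg Complex.re h
      rw [hre, Complex.one_re] at h2
      linarith
    have hhalf : ((2 * (n + 1) : ℕ) : ℂ) / 2 = (n : ℂ) + 1 := by push_cast; ring
    rw [riemannXi_eq (by rw [hre]; positivity) h1, Complex.Gammaℝ_def, hhalf,
      Complex.Gamma_nat_eq_factorial, neg_div, hhalf]
    simp only [norm_mul, Complex.norm_natCast]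
    have hpi : ‖(Real.pi : ℂ) ^ (-((n : ℂ) + 1))‖ = (Real.pi ^ (n + 1))⁻¹ := by
      rw [Complex.norm_cpow_eq_rpow_re_of_pos Real.pi_pos, ← Real.rpow_natCast,
        ← Real.rpow_neg Real.pi_pos.le]
      congr 1
      simp
    have hζ := one_le_norm_riemannZeta_natCast (k := 2 * (n + 1)) (by omega)
    have h3 : (1 : ℝ) ≤ ((2 * (n + 1) : ℕ) : ℝ) := by push_cast; linarith
    have h4 : 1 ≤ ‖((2 * (n + 1) : ℕ) : ℂ) - 1‖ := by
      refine le_trans ?_ (Complex.re_le_norm _)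
      rw [Complex.sub_re, hre, Complex.one_re]
      linarith
    rw [hpi]
    calc (n.factorial : ℝ) * (Real.pi ^ (n + 1))⁻¹
        = 1 * 1 * ((Real.pi ^ (n + 1))⁻¹ * n.factorial * 1) := by ring
      _ ≤ _ := by
          have := Real.pi_pos
          gcongr
  have hup := hAB ((2 * (n + 1) : ℕ) : ℂ)
  have hdist : ‖((2 * (n + 1) : ℕ) : ℂ) - 1 / 2‖ ≤ 2 * ((n : ℝ) + 1) := by
    have h1 : ((2 * (n + 1) : ℕ) : ℂ) - 1 / 2 = ((2 * ((n : ℝ) + 1) - 1 / 2 : ℝ) : ℂ) := by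
      push_cast; ring
    have hn0 : (0 : ℝ) ≤ n := Nat.cast_nonneg n
    rw [h1, Complex.norm_real, Real.norm_eq_abs, abs_of_nonneg (by linarith)]
    linarith
  have hup2 : Real.exp (B * ‖((2 * (n + 1) : ℕ) : ℂ) - 1 / 2‖) ≤ Real.exp (2 * |B|) ^ (n + 1) := by
    rw [← Real.exp_nat_mul]
    refine Real.exp_le_exp.2 ?_
    calc B * ‖((2 * (n + 1) : ℕ) : ℂ) - 1 / 2‖ ≤ |B| * (2 * ((n : ℝ) + 1)) := by
          gcongr
          exact le_abs_self B
      _ = _ := by push_cast; ring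
  have hfinal : (n.factorial : ℝ) ≤ A * K * K ^ n := by
    have h1 := hlow.trans (hup.trans (mul_le_mul_of_nonneg_left hup2 hA.le))
    have hπ : 0 < Real.pi ^ (n + 1) := pow_pos Real.pi_pos _
    rw [← div_eq_mul_inv, div_le_iff₀ hπ] at h1
    refine h1.trans (le_of_eq ?_)
    rw [hK, mul_assoc A, mul_assoc A, ← pow_succ', mul_pow]
    ring
  have hfac : (0 : ℝ) < n.factorial := by positivity
  rw [div_lt_div_iff₀ hfac (by positivity)] at hn
  linarith

/-! ### Dirichlet series and Euler products over the odd primes. -/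

theorem riemannZeta_two_mul_natCast {m : ℕ} (hm : 1 ≤ m) :
    riemannZeta (2 * (m : ℂ)) = ((∑' n : ℕ, 1 / (n : ℝ) ^ (2 * m) : ℝ) : ℂ) := by
  have h := zeta_nat_eq_tsum_of_gt_one (k := 2 * m) (by omega)
  push_cast at h ⊢
  rw [h]

theorem summable_one_div_two_mul_add_one_pow {m : ℕ} (hm : 1 ≤ m) :
    Summable fun n : ℕ => 1 / (2 * (n : ℝ) + 1) ^ (2 * m) := by
  have h := (Real.summable_one_div_nat_pow.2 (show 1 < 2 * m by omega)).comp_injective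
    (i := fun n : ℕ => 2 * n + 1) (fun a b h => by simpa using h)
  refine h.congr fun n => ?_
  simp

theorem hasSum_one_div_two_mul_add_one_pow {m : ℕ} (hm : 1 ≤ m) :
    HasSum (fun n : ℕ => 1 / (2 * (n : ℝ) + 1) ^ (2 * m))
      ((1 - 1 / 2 ^ (2 * m)) * (riemannZeta (2 * (m : ℂ))).re) := by
  rw [riemannZeta_two_mul_natCast hm, Complex.ofReal_re]
  set Z := ∑' n : ℕ, 1 / (n : ℝ) ^ (2 * m) with hZ
  have hsum : HasSum (fun n : ℕ => 1 / (n : ℝ) ^ (2 * m)) Z :=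
    (Real.summable_one_div_nat_pow.2 (show 1 < 2 * m by omega)).hasSum
  have heven : HasSum (fun n : ℕ => 1 / ((2 * n : ℕ) : ℝ) ^ (2 * m)) (1 / 2 ^ (2 * m) * Z) := by
    refine (hsum.mul_left (1 / 2 ^ (2 * m))).congr_fun fun n => ?_
    push_cast
    rw [mul_pow]
    field_simp
  have hodd := (summable_one_div_two_mul_add_one_pow hm).hasSum
  have hodd' : HasSum (fun n : ℕ => 1 / ((2 * n + 1 : ℕ) : ℝ) ^ (2 * m))
      (∑' n : ℕ, 1 / (2 * (n : ℝ) + 1) ^ (2 * m)) := by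
    refine hodd.congr_fun fun n => ?_
    push_cast
    rfl
  have h := (HasSum.even_add_odd (f := fun n : ℕ => 1 / (n : ℝ) ^ (2 * m)) heven hodd').unique hsum
  convert hodd using 1
  linear_combination -h

theorem hasSum_dirichletBeta {m : ℕ} (hm : 1 ≤ m) :
    HasSum (fun n : ℕ => (-1 : ℝ) ^ n / (2 * (n : ℝ) + 1) ^ (2 * m))
      (dirichletBeta (2 * (m : ℝ))) := by
  have hterm : ∀ n : ℕ, (-1 : ℝ) ^ n / (2 * (n : ℝ) + 1) ^ (2 * (m : ℝ))
      = (-1 : ℝ) ^ n / (2 * (n : ℝ) + 1) ^ (2 * m) := by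
    intro n
    rw [show 2 * (m : ℝ) = ((2 * m : ℕ) : ℝ) by push_cast; ring, Real.rpow_natCast]
  rw [dirichletBeta, tsum_congr hterm]
  refine (Summable.of_norm ?_).hasSum
  refine (summable_one_div_two_mul_add_one_pow hm).congr fun n => ?_
  rw [norm_div, norm_pow, norm_neg, norm_one, one_pow, Real.norm_of_nonneg (by positivity)]

/-- Averaging the plain and the alternating series over odd integers 2n + 1 keeps exactly the terms
with n even. -/
theorem hasSum_one_div_four_mul_add_one_pow {m : ℕ} (hm : 1 ≤ m) :
    HasSum (fun n : ℕ => 1 / (4 * (n : ℝ) + 1) ^ (2 * m))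
      (((1 - 1 / 2 ^ (2 * m)) * (riemannZeta (2 * (m : ℂ))).re + dirichletBeta (2 * (m : ℝ))) / 2) := by
  have h := ((hasSum_one_div_two_mul_add_one_pow hm).add (hasSum_dirichletBeta hm)).div_const 2
  have hinj : Function.Injective fun n : ℕ => 2 * n := fun a b h => by simpa using h
  rw [← hinj.hasSum_iff] at h
  · refine h.congr_fun fun n => ?_
    simp only [Function.comp_apply, pow_mul, neg_one_sq, one_pow]
    push_cast
    ring
  · intro n hn
    have hodd : Odd n := by
      rw [← Nat.not_even_iff_odd]
      rintro ⟨k, hk⟩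
      exact hn ⟨k, by simp; omega⟩
    simp [hodd.neg_one_pow, neg_div]

/-- The completely multiplicative function `n ↦ χ₄(n) ^ j / n ^ (2 m)`. -/
def chiFourPowDivPow (m j : ℕ) (hm : 1 ≤ m) : ℕ →*₀ ℝ where
  toFun n := (ZMod.χ₄ (n : ZMod 4) : ℝ) ^ j / (n : ℝ) ^ (2 * m)
  map_zero' := by simp; right; omega
  map_one' := by simp
  map_mul' a b := by
    simp only [Nat.cast_mul, map_mul, Int.cast_mul, mul_pow]
    rw [mul_div_mul_comm]

theorem hasProd_oddPrimes {f : ℕ →*₀ ℝ} (h2 : f 2 = 0) (hf : Summable fun n => ‖f n‖) :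
    HasProd (fun p : OddPrimes => (1 - f p)⁻¹) (∑' n, f n) := by
  have h := EulerProduct.eulerProduct_completely_multiplicative_hasProd hf
  let i : OddPrimes → Nat.Primes := fun p => ⟨p.1, p.2.1⟩
  have hinj : Function.Injective i := fun p q hpq => Subtype.ext (congrArg (fun r : Nat.Primes => (r : ℕ)) hpq)
  rw [← hinj.hasProd_iff] at h
  · exact h
  · intro p hp
    have hp2 : (p : ℕ) = 2 := by
      by_contra hne
      exact hp ⟨⟨p, p.2, by have := p.2.two_le; omega⟩, rfl⟩
    rw [hp2, h2]
    simp

/-- Treats both Euler products at once: j = 1 gives β, and j = 2 gives (1 - 2^(-2m))ζ(2m) because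
χ₄² is the principal character modulo 4. -/
theorem hasProd_chiFourPowDivPow {m j : ℕ} (hm : 1 ≤ m) (hj : 1 ≤ j) :
    HasProd (fun p : OddPrimes => (1 - chiFourPowDivPow m j hm p)⁻¹)
      (∑' n : ℕ, ((-1 : ℝ) ^ n) ^ j / (2 * (n : ℝ) + 1) ^ (2 * m)) := by
  have hodd : ∀ n : ℕ, chiFourPowDivPow m j hm (2 * n + 1)
      = ((-1 : ℝ) ^ n) ^ j / (2 * (n : ℝ) + 1) ^ (2 * m) := by
    intro n
    have h1 : (2 * n + 1) / 2 = n := by omega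
    simp only [chiFourPowDivPow, MonoidWithZeroHom.coe_mk, ZeroHom.coe_mk]
    rw [ZMod.χ₄_eq_neg_one_pow (n := 2 * n + 1) (by omega), h1]
    push_cast
    rfl
  have heven : ∀ n : ℕ, n ∉ Set.range (fun n : ℕ => 2 * n + 1) → chiFourPowDivPow m j hm n = 0 := by
    intro n hn
    have h1 : n % 2 = 0 := by
      by_contra h
      exact hn ⟨n / 2, by simp; omega⟩
    simp only [chiFourPowDivPow, MonoidWithZeroHom.coe_mk, ZeroHom.coe_mk]
    rw [ZMod.χ₄_nat_eq_if_mod_four, if_pos h1]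
    simp
    left; omega
  have hinj : Function.Injective fun n : ℕ => 2 * n + 1 := fun a b h => by simpa using h
  have hsum : Summable fun n => ‖chiFourPowDivPow m j hm n‖ := by
    rw [← hinj.summable_iff]
    · refine (summable_one_div_two_mul_add_one_pow hm).congr fun n => ?_
      rw [Function.comp_apply, hodd, norm_div, norm_pow, norm_pow, norm_neg, norm_one, one_pow,
        one_pow, Real.norm_of_nonneg (by positivity)]
    · intro n hn
      rw [heven n hn, norm_zero]
  have h := hasProd_oddPrimes (heven 2 (by rintro ⟨k, hk⟩; simp only at hk; omega)) hsum
  have h2 : ∑' n : ℕ, ((-1 : ℝ) ^ n) ^ j / (2 * (n : ℝ) + 1) ^ (2 * m)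
      = ∑' n, chiFourPowDivPow m j hm n := by
    rw [← hinj.tsum_eq (f := chiFourPowDivPow m j hm)]
    · exact tsum_congr fun n => (hodd n).symm
    · intro n hn
      by_contra h
      exact hn (heven n h)
  rw [h2]
  exact h

theorem hasProd_betaEulerFactor {m : ℕ} (hm : 1 ≤ m) :
    HasProd (betaEulerFactor m) (dirichletBeta (2 * (m : ℝ))) := by
  have h := hasProd_chiFourPowDivPow (j := 1) hm le_rfl
  simp only [pow_one] at h
  rw [(hasSum_dirichletBeta hm).tsum_eq] at h
  refine h.congr_fun fun p => ?_
  simp [betaEulerFactor, chiFourPowDivPow]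

theorem hasProd_zetaEulerFactor {m : ℕ} (hm : 1 ≤ m) :
    HasProd (zetaEulerFactor m) ((1 - 1 / 2 ^ (2 * m)) * (riemannZeta (2 * (m : ℂ))).re) := by
  have h := hasProd_chiFourPowDivPow (j := 2) hm one_le_two
  have h1 : ∀ n : ℕ, ((-1 : ℝ) ^ n) ^ 2 = 1 := fun n => by rw [← pow_mul, mul_comm, pow_mul]; simp
  simp only [h1] at h
  rw [(hasSum_one_div_two_mul_add_one_pow hm).tsum_eq] at h
  refine h.congr_fun fun p => ?_
  have hodd : (p : ℕ) % 2 = 1 := by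
    rcases p.2.1.eq_two_or_odd with h | h
    · have := p.2.2; omega
    · exact h
  simp only [zetaEulerFactor, chiFourPowDivPow, MonoidWithZeroHom.coe_mk, ZeroHom.coe_mk]
  rw [ZMod.χ₄_eq_neg_one_pow hodd]
  push_cast
  rw [h1]

/-- The contribution of the archimedean factor. -/
theorem iteratedDeriv_logDeriv_Gammaℝ_one_half {m : ℕ} (hm : 1 ≤ m) :
    iteratedDeriv (2 * m - 1) (logDeriv Complex.Gammaℝ) (1 / 2)
      = (((2 * m - 1).factorial * 2 ^ (2 * m) *
        (((1 - 1 / 2 ^ (2 * m)) * (riemannZeta (2 * (m : ℂ))).re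
          + dirichletBeta (2 * (m : ℝ))) / 2) : ℝ) : ℂ) := by
  have h1 := tendsto_sum_iteratedDeriv_logDeriv_Gammaℝ (k := 2 * m - 1) (by omega)
  have h2 := ((hasSum_one_div_four_mul_add_one_pow hm).tendsto_sum_nat.const_mul
    (((2 * m - 1).factorial : ℝ) * 2 ^ (2 * m)))
  refine tendsto_nhds_unique h1 ?_
  refine ((Complex.continuous_ofReal.tendsto _).comp h2).congr fun N => ?_
  have hodd : Odd (2 * m - 1) := ⟨m - 1, by omega⟩
  have hsucc : 2 * m - 1 + 1 = 2 * m := by omega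
  simp only [Function.comp_apply, hodd.neg_one_pow, hsucc]
  push_cast
  rw [← Finset.sum_neg_distrib, Finset.mul_sum]
  refine Finset.sum_congr rfl fun n _ => ?_
  have : (1 / 2 + 2 * n : ℂ) = (4 * n + 1) / 2 := by ring
  rw [this, div_pow, inv_div]
  ring

/-! ### The ordinates under the Riemann Hypothesis. -/

open Complex in
/-- Multiplicity of `1 / 2 + i t` as a zero of `riemannXi`, for `t > 0`. -/
def ordinateMult (t : ℝ) : ℕ := if 0 < t then analyticOrderNatAt riemannXi (1 / 2 + t * I) else 0

theorem analyticOrderNatAt_riemannXi_ne_zero_iff {s : ℂ} :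
    analyticOrderNatAt riemannXi s ≠ 0 ↔ riemannXi s = 0 := by
  have htop := analyticOrderAt_ne_top_of_differentiable differentiable_riemannXi
    riemannXi_one_half_ne_zero s
  rw [← not_iff_not, not_ne_iff, ← ne_eq (riemannXi s),
    ← (differentiable_riemannXi.analyticAt s).analyticOrderAt_eq_zero,
    ← Nat.cast_analyticOrderNatAt htop]
  norm_cast

theorem ordinateMult_ne_zero_iff {t : ℝ} :
    ordinateMult t ≠ 0 ↔ 0 < t ∧ riemannXi (1 / 2 + t * Complex.I) = 0 := by
  rw [ordinateMult, ← analyticOrderNatAt_riemannXi_ne_zero_iff]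
  split_ifs with h <;> simp [h]

theorem finite_closedBall_inter_riemannXi_zeros (c : ℂ) (R : ℝ) :
    {s | riemannXi s = 0 ∧ dist s c ≤ R}.Finite := by
  refine ((isCompact_closedBall c R).inter_riemannZetaZeros_finite).subset ?_
  rintro s ⟨h, hs⟩
  exact ⟨hs, (riemannXi_eq_zero_iff.1 h).1⟩

/-- The zeros of `riemannXi` at distance at most `R` from `1 / 2`. -/
def xiZeros (R : ℝ) : Finset ℂ := (finite_closedBall_inter_riemannXi_zeros (1 / 2) R).toFinset

theorem mem_xiZeros {R : ℝ} {s : ℂ} : s ∈ xiZeros R ↔ riemannXi s = 0 ∧ dist s (1 / 2) ≤ R := by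
  simp [xiZeros]

theorem dist_half_add_mul_I {t : ℝ} (ht : 0 < t) :
    dist (1 / 2 + t * Complex.I) (1 / 2) = t := by
  rw [dist_eq_norm, add_sub_cancel_left, norm_mul, Complex.norm_I, mul_one, Complex.norm_real,
    Real.norm_of_nonneg ht.le]

theorem half_add_mul_I_injective : Function.Injective fun t : ℝ => (1 / 2 + t * Complex.I : ℂ) := by
  intro a b h
  simpa using congrArg Complex.im h

theorem finite_ordinateMult_ne_zero (T : ℝ) : {t | ordinateMult t ≠ 0 ∧ t ≤ T}.Finite := by
  refine Set.Finite.of_finite_image ((xiZeros T).finite_toSet.subset ?_)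
    half_add_mul_I_injective.injOn
  rintro _ ⟨t, ⟨ht, htT⟩, rfl⟩
  rw [ordinateMult_ne_zero_iff] at ht
  rw [Finset.mem_coe, mem_xiZeros]
  exact ⟨ht.2, (dist_half_add_mul_I ht.1).trans_le htT⟩

/-- The ordinates up to `T` of the zeros on the critical line in the upper half plane. -/
def ordinatesUpTo (T : ℝ) : Finset ℝ := (finite_ordinateMult_ne_zero T).toFinset

theorem mem_ordinatesUpTo (T t : ℝ) : t ∈ ordinatesUpTo T ↔ ordinateMult t ≠ 0 ∧ t ≤ T := by
  simp [ordinatesUpTo]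

theorem RiemannHypothesis.re_eq (hRH : RiemannHypothesis) {s : ℂ} (hs : riemannXi s = 0) :
    s.re = 1 / 2 := by
  obtain ⟨h, h0, h1⟩ := riemannXi_eq_zero_iff.1 hs
  refine hRH s h ?_ ?_
  · rintro ⟨n, rfl⟩
    have : (-2 * ((n : ℂ) + 1)).re = -2 * ((n : ℝ) + 1) := by simp
    rw [this] at h0
    linarith [(Nat.cast_nonneg n : (0 : ℝ) ≤ n)]
  · rintro rfl
    simp at h1

theorem RiemannHypothesis.eq_half_add (hRH : RiemannHypothesis) {s : ℂ} (hs : riemannXi s = 0) :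
    s = 1 / 2 + (s.im : ℂ) * Complex.I := by
  apply Complex.ext
  · simp [hRH.re_eq hs]
  · simp

/-- RH by itself would allow a zero at 1/2; the numerical bound at the centre excludes it. -/
theorem RiemannHypothesis.im_ne_zero (hRH : RiemannHypothesis) {s : ℂ} (hs : riemannXi s = 0) :
    s.im ≠ 0 := by
  intro h
  have := hRH.eq_half_add hs
  rw [h] at this
  simp only [Complex.ofReal_zero, zero_mul, add_zero] at this
  exact riemannXi_one_half_ne_zero (this ▸ hs)

theorem half_sub_mul_I (t : ℝ) :
    (1 / 2 - t * Complex.I : ℂ) = 1 - (1 / 2 + t * Complex.I) := by ring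

theorem riemannXi_half_sub (t : ℝ) :
    riemannXi (1 / 2 - t * Complex.I) = riemannXi (1 / 2 + t * Complex.I) := by
  rw [half_sub_mul_I, riemannXi_one_sub]

/-- Identifies the index set of the `finsum` with a finite image of ordinates, so the sum is genuine
and not the default value 0. It brings `zetaOrdinate` under the enumeration lemmas. -/
theorem RiemannHypothesis.zetaZeroCount_eq (hRH : RiemannHypothesis) (T : ℝ) :
    zetaZeroCount T = ∑ t ∈ ordinatesUpTo T, ordinateMult t := by
  classical
  have hset : {ρ : ℂ | riemannZeta ρ = 0 ∧ 0 < ρ.re ∧ ρ.re < 1 ∧ 0 < ρ.im ∧ ρ.im ≤ T}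
      = (((ordinatesUpTo T).image fun t : ℝ => (1 / 2 + t * Complex.I : ℂ) : Finset ℂ) : Set ℂ) := by
    ext ρ
    simp only [Set.mem_ofPred_eq, Finset.coe_image, Set.mem_image, Finset.mem_coe,
      mem_ordinatesUpTo, ordinateMult_ne_zero_iff]
    constructor
    · rintro ⟨h, h0, h1, h2, h3⟩
      have hξ := riemannXi_eq_zero_iff.2 ⟨h, h0, h1⟩
      have he := hRH.eq_half_add hξ
      exact ⟨ρ.im, ⟨⟨h2, he ▸ hξ⟩, h3⟩, he.symm⟩
    · rintro ⟨t, ⟨⟨h0, hξ⟩, hT⟩, rfl⟩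
      obtain ⟨ha, hb, hc⟩ := riemannXi_eq_zero_iff.1 hξ
      exact ⟨ha, hb, hc, by simpa using h0, by simpa using hT⟩
  rw [zetaZeroCount, hset, finsum_mem_coe_finset,
    Finset.sum_image half_add_mul_I_injective.injOn]
  refine Finset.sum_congr rfl fun t ht => ?_
  obtain ⟨h0, hξ⟩ := ordinateMult_ne_zero_iff.1 ((mem_ordinatesUpTo _ _).1 ht).1
  obtain ⟨-, hb, hc⟩ := riemannXi_eq_zero_iff.1 hξ
  rw [ordinateMult, if_pos h0, analyticOrderNatAt_riemannXi hb]
  intro h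
  rw [h] at hc
  simp at hc

theorem RiemannHypothesis.infinite_ordinates (hRH : RiemannHypothesis) :
    {t | ordinateMult t ≠ 0}.Infinite := by
  intro hfin
  apply infinite_setOf_riemannXi_eq_zero
  refine ((hfin.image fun t : ℝ => (1 / 2 + t * Complex.I : ℂ)).union
    (hfin.image fun t : ℝ => (1 / 2 - t * Complex.I : ℂ))).subset fun s hs => ?_
  have hs : riemannXi s = 0 := hs
  have he := hRH.eq_half_add hs
  rcases lt_or_gt_of_ne (hRH.im_ne_zero hs) with h | h
  · right
    have he' : s = 1 / 2 - ((-s.im : ℝ) : ℂ) * Complex.I := by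
      rw [Complex.ofReal_neg, neg_mul, sub_neg_eq_add]; exact he
    refine ⟨-s.im, ordinateMult_ne_zero_iff.2 ⟨by linarith, ?_⟩, he'.symm⟩
    rw [← riemannXi_half_sub, ← he', hs]
  · left
    exact ⟨s.im, ordinateMult_ne_zero_iff.2 ⟨h, he ▸ hs⟩, he.symm⟩

theorem RiemannHypothesis.exists_le_zetaZeroCount (hRH : RiemannHypothesis) (n : ℕ) :
    ∃ T, n ≤ zetaZeroCount T :=
  exists_le_sum_mult_of_infinite mem_ordinatesUpTo hRH.zetaZeroCount_eq hRH.infinite_ordinates n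

theorem RiemannHypothesis.zetaOrdinate_le_iff (hRH : RiemannHypothesis) {n : ℕ} (hn : 1 ≤ n)
    (T : ℝ) : zetaOrdinate n ≤ T ↔ n ≤ zetaZeroCount T :=
  sInf_setOf_le_sum_mult_le_iff mem_ordinatesUpTo hRH.zetaZeroCount_eq
    hRH.exists_le_zetaZeroCount hn T

theorem RiemannHypothesis.zetaOrdinate_spec (hRH : RiemannHypothesis) {n : ℕ} (hn : 1 ≤ n) :
    0 < zetaOrdinate n ∧ riemannXi (1 / 2 + zetaOrdinate n * Complex.I) = 0 :=
  ordinateMult_ne_zero_iff.1 (mult_sInf_setOf_le_sum_mult_ne_zero mem_ordinatesUpTo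
    hRH.zetaZeroCount_eq hRH.exists_le_zetaZeroCount hn)

theorem RiemannHypothesis.zetaOrdinate_mono (hRH : RiemannHypothesis) {k n : ℕ} (hk : 1 ≤ k)
    (hkn : k ≤ n) : zetaOrdinate k ≤ zetaOrdinate n :=
  (hRH.zetaOrdinate_le_iff hk _).2
    (hkn.trans ((hRH.zetaOrdinate_le_iff (hk.trans hkn) _).1 le_rfl))

theorem RiemannHypothesis.exists_zetaOrdinate_eq (hRH : RiemannHypothesis) {t : ℝ} (ht : 0 < t)
    (hξ : riemannXi (1 / 2 + t * Complex.I) = 0) : ∃ n, 1 ≤ n ∧ zetaOrdinate n = t :=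
  exists_sInf_setOf_le_sum_mult_eq mem_ordinatesUpTo hRH.zetaZeroCount_eq
    hRH.exists_le_zetaZeroCount (ordinateMult_ne_zero_iff.2 ⟨ht, hξ⟩)

theorem RiemannHypothesis.nontrivial_zero_iff (hRH : RiemannHypothesis) (ρ : ℂ) :
    (riemannZeta ρ = 0 ∧ 0 < ρ.re ∧ ρ.re < 1) ↔
      ∃ n : ℕ, 1 ≤ n ∧ (ρ = 1 / 2 + (zetaOrdinate n : ℂ) * Complex.I ∨
        ρ = 1 / 2 - (zetaOrdinate n : ℂ) * Complex.I) := by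
  rw [← riemannXi_eq_zero_iff]
  constructor
  · intro hs
    have he := hRH.eq_half_add hs
    rcases lt_or_gt_of_ne (hRH.im_ne_zero hs) with h | h
    · have he' : ρ = 1 / 2 - ((-ρ.im : ℝ) : ℂ) * Complex.I := by
        rw [Complex.ofReal_neg, neg_mul, sub_neg_eq_add]; exact he
      obtain ⟨n, hn, hnt⟩ := hRH.exists_zetaOrdinate_eq (t := -ρ.im) (by linarith)
        (by rw [← riemannXi_half_sub, ← he', hs])
      exact ⟨n, hn, Or.inr (by rw [hnt]; exact he')⟩
    · obtain ⟨n, hn, hnt⟩ := hRH.exists_zetaOrdinate_eq h (he ▸ hs)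
      exact ⟨n, hn, Or.inl (by rw [hnt]; exact he)⟩
  · rintro ⟨n, hn, rfl | rfl⟩
    · exact (hRH.zetaOrdinate_spec hn).2
    · rw [riemannXi_half_sub]
      exact (hRH.zetaOrdinate_spec hn).2

/-- Sums over the zeros within distance `R` of `1 / 2`, rewritten over the ordinates. -/
theorem RiemannHypothesis.sum_xiZeros (hRH : RiemannHypothesis) (φ : ℂ → ℂ) (R : ℝ) :
    ∑ s ∈ xiZeros R, analyticOrderNatAt riemannXi s * φ s
      = ∑ t ∈ ordinatesUpTo R,
          ordinateMult t * (φ (1 / 2 + t * Complex.I) + φ (1 / 2 - t * Complex.I)) := by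
  classical
  have hinj' : Function.Injective fun t : ℝ => (1 / 2 - t * Complex.I : ℂ) := by
    intro a b h
    simpa using congrArg Complex.im h
  have hZ : xiZeros R = ((ordinatesUpTo R).image fun t : ℝ => (1 / 2 + t * Complex.I : ℂ))
      ∪ (ordinatesUpTo R).image fun t : ℝ => (1 / 2 - t * Complex.I : ℂ) := by
    ext s
    simp only [mem_xiZeros, Finset.mem_union, Finset.mem_image, mem_ordinatesUpTo,
      ordinateMult_ne_zero_iff]
    constructor
    · rintro ⟨hs, hd⟩
      have he := hRH.eq_half_add hs
      have hd' : |s.im| ≤ R := by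
        rw [he, dist_eq_norm, add_sub_cancel_left, norm_mul, Complex.norm_I, mul_one,
          Complex.norm_real, Real.norm_eq_abs] at hd
        exact hd
      rcases lt_or_gt_of_ne (hRH.im_ne_zero hs) with h | h
      · right
        have he' : s = 1 / 2 - ((-s.im : ℝ) : ℂ) * Complex.I := by
          rw [Complex.ofReal_neg, neg_mul, sub_neg_eq_add]; exact he
        refine ⟨-s.im, ⟨⟨by linarith, ?_⟩, (neg_le_abs _).trans hd'⟩, he'.symm⟩
        rw [← riemannXi_half_sub, ← he', hs]
      · left
        exact ⟨s.im, ⟨⟨h, he ▸ hs⟩, (le_abs_self _).trans hd'⟩, he.symm⟩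
    · rintro (⟨t, ⟨⟨h0, hξ⟩, hT⟩, rfl⟩ | ⟨t, ⟨⟨h0, hξ⟩, hT⟩, rfl⟩)
      · exact ⟨hξ, (dist_half_add_mul_I h0).trans_le hT⟩
      · refine ⟨by rw [riemannXi_half_sub, hξ], ?_⟩
        rw [dist_eq_norm, sub_sub_cancel_left, norm_neg, norm_mul, Complex.norm_I, mul_one,
          Complex.norm_real, Real.norm_of_nonneg h0.le]
        exact hT
  rw [hZ, Finset.sum_union, Finset.sum_image half_add_mul_I_injective.injOn,
    Finset.sum_image hinj'.injOn, ← Finset.sum_add_distrib]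
  · refine Finset.sum_congr rfl fun t ht => ?_
    obtain ⟨h0, -⟩ := ordinateMult_ne_zero_iff.1 ((mem_ordinatesUpTo _ _).1 ht).1
    rw [half_sub_mul_I, analyticOrderNatAt_riemannXi_one_sub, ordinateMult, if_pos h0]
    ring
  · rw [Finset.disjoint_left]
    intro s hs hs'
    rw [Finset.mem_image] at hs hs'
    obtain ⟨t, ht, rfl⟩ := hs
    obtain ⟨u, hu, h⟩ := hs'
    have h1 := (ordinateMult_ne_zero_iff.1 ((mem_ordinatesUpTo _ _).1 ht).1).1
    have h2 := (ordinateMult_ne_zero_iff.1 ((mem_ordinatesUpTo _ _).1 hu).1).1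
    have h3 : -u = t := by simpa using congrArg Complex.im h
    linarith

theorem RiemannHypothesis.tendsto_zetaZeroCount (hRH : RiemannHypothesis) :
    Tendsto zetaZeroCount atTop atTop :=
  tendsto_atTop_atTop_of_monotone (monotone_of_sum_mult mem_ordinatesUpTo hRH.zetaZeroCount_eq)
    hRH.exists_le_zetaZeroCount

theorem sum_range_eq_sum_Icc_one (f : ℕ → ℝ) (n : ℕ) :
    ∑ k ∈ Finset.range n, f (k + 1) = ∑ k ∈ Finset.Icc 1 n, f k := by
  rw [Finset.range_eq_Ico, Finset.sum_Ico_add' f 0 n 1]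
  rfl

/-! ### Power sums of the ordinates and the Voros expression. -/

/-- The power sums of the ordinates in terms of the logarithmic derivative of `riemannXi`. -/
theorem RiemannHypothesis.hasSum_zetaOrdinate (hRH : RiemannHypothesis) {m : ℕ} (hm : 1 ≤ m) :
    HasSum (fun k : ℕ => 1 / zetaOrdinate (k + 1) ^ (2 * m))
      ((-1) ^ (m + 1) / 2 * ((2 * m - 1).factorial : ℝ)⁻¹ *
        (iteratedDeriv (2 * m - 1) (logDeriv riemannXi) (1 / 2)).re) := by
  obtain ⟨M, hM, hMo⟩ := exists_norm_riemannXi_le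
  have h := tendsto_sum_zeros_iteratedDeriv_logDeriv differentiable_riemannXi
    riemannXi_one_half_ne_zero hM hMo (Z := xiZeros) (fun R a => mem_xiZeros)
    (k := 2 * m - 1) (by omega)
  have hodd : Odd (2 * m - 1) := ⟨m - 1, by omega⟩
  have hsucc : 2 * m - 1 + 1 = 2 * m := by omega
  have hfac : ((2 * m - 1).factorial : ℝ) ≠ 0 := by positivity
  have hpar : ((-1 : ℝ) ^ m) ^ 2 = 1 := by rw [← pow_mul, mul_comm, pow_mul]; simp
  have hparC : ((-1 : ℂ) ^ m) ^ 2 = 1 := by rw [← pow_mul, mul_comm, pow_mul]; simp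
  have hsum : ∀ R, ∑ a ∈ xiZeros R, analyticOrderNatAt riemannXi a *
      ((-1 : ℂ) ^ (2 * m - 1) * (2 * m - 1).factorial * ((1 / 2 - a) ^ (2 * m - 1 + 1))⁻¹)
      = ((-2 * (-1) ^ m * (2 * m - 1).factorial *
        ∑ k ∈ Finset.range (zetaZeroCount R), 1 / zetaOrdinate (k + 1) ^ (2 * m) : ℝ) : ℂ) := by
    intro R
    have h1 : ∑ k ∈ Finset.range (zetaZeroCount R), 1 / zetaOrdinate (k + 1) ^ (2 * m)
        = ∑ t ∈ ordinatesUpTo R, ordinateMult t * (1 / t ^ (2 * m)) := by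
      rw [sum_range_eq_sum_Icc_one (fun k => 1 / zetaOrdinate k ^ (2 * m))]
      exact sum_sInf_setOf_le_sum_mult mem_ordinatesUpTo hRH.zetaZeroCount_eq
        hRH.exists_le_zetaZeroCount (fun t => 1 / t ^ (2 * m)) R
    rw [hRH.sum_xiZeros (fun a => (-1 : ℂ) ^ (2 * m - 1) * (2 * m - 1).factorial *
      ((1 / 2 - a) ^ (2 * m - 1 + 1))⁻¹), h1, hodd.neg_one_pow, hsucc]
    push_cast
    rw [Finset.mul_sum]
    refine Finset.sum_congr rfl fun t ht => ?_
    -- The even exponent makes both members of the pair 1/2 ± it contribute the same real number.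
    have h2 : ((1 / 2 : ℂ) - (1 / 2 + t * Complex.I)) ^ (2 * m) = (-1) ^ m * (t : ℂ) ^ (2 * m) := by
      rw [sub_add_cancel_left, neg_pow, mul_pow, pow_mul Complex.I, Complex.I_sq, pow_mul (-1 : ℂ)]
      simp [mul_comm]
    have h3 : ((1 / 2 : ℂ) - (1 / 2 - t * Complex.I)) ^ (2 * m) = (-1) ^ m * (t : ℂ) ^ (2 * m) := by
      rw [sub_sub_cancel, mul_pow, pow_mul Complex.I, Complex.I_sq, mul_comm]
    have h4 : ((-1 : ℂ) ^ m)⁻¹ = (-1) ^ m := by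
      rw [inv_eq_iff_eq_inv, ← one_div, eq_div_iff (by simp), ← sq, hparC]
    rw [h2, h3, mul_inv, h4]
    ring
  simp only [hsum] at h
  have h' := (Complex.continuous_re.tendsto _).comp h
  have h'' := h'.const_mul ((-1) ^ (m + 1) / 2 * ((2 * m - 1).factorial : ℝ)⁻¹)
  have hnonneg : ∀ k : ℕ, 0 ≤ 1 / zetaOrdinate (k + 1) ^ (2 * m) := fun k =>
    one_div_nonneg.2 (pow_nonneg (hRH.zetaOrdinate_spec (by omega)).1.le _)
  -- Partial fractions control only the partial sums of length `zetaZeroCount R`. As the terms are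
  -- nonnegative, the partial sums are monotone and convergence along this unbounded sequence of
  -- lengths suffices.
  rw [hasSum_iff_tendsto_nat_of_nonneg hnonneg,
    tendsto_iff_tendsto_subseq_of_monotone (φ := zetaZeroCount) ?_ hRH.tendsto_zetaZeroCount]
  · refine h''.congr fun R => ?_
    simp only [Function.comp_apply, Complex.ofReal_re]
    rw [pow_succ]
    field_simp
    linear_combination (∑ k ∈ Finset.range (zetaZeroCount R), 1 / zetaOrdinate (k + 1) ^ (2 * m)) * hpar
  · exact fun a b hab => Finset.sum_le_sum_of_subset_of_nonneg (Finset.range_mono hab)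
      fun k _ _ => hnonneg k

/-- Voros' expression equals the corresponding logarithmic derivative of `riemannXi`. -/
theorem vorosExpression_eq {m : ℕ} (hm : 1 ≤ m) :
    vorosExpression m ((1 - 1 / 2 ^ (2 * m)) * (riemannZeta (2 * (m : ℂ))).re)
        (dirichletBeta (2 * (m : ℝ)))
      = (-1) ^ (m + 1) / 2 * ((2 * m - 1).factorial : ℝ)⁻¹ *
        (iteratedDeriv (2 * m - 1) (logDeriv riemannXi) (1 / 2)).re := by
  have hodd : Odd (2 * m - 1) := ⟨m - 1, by omega⟩
  have hsucc : 2 * m - 1 + 1 = 2 * m := by omega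
  have hne1 : (1 / 2 : ℂ) ≠ 1 := by norm_num
  have hhalf : ((1 / 2 : ℝ) : ℂ) = 1 / 2 := by norm_num
  have hlog : logAbsZetaDeriv (2 * m)
      = (iteratedDeriv (2 * m - 1) (logDeriv riemannZeta) (1 / 2)).re := by
    have h := iteratedDeriv_log_norm (f := riemannZeta) (a := 1 / 2)
      (by rw [hhalf]; exact analyticAt_riemannZeta hne1)
      (by rw [hhalf]; exact riemannZeta_one_half_ne_zero) (2 * m - 1)
    rw [hsucc, hhalf] at h
    exact h
  have hxi := iteratedDeriv_logDeriv_riemannXi (s := 1 / 2) (by norm_num) hne1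
    riemannZeta_one_half_ne_zero (2 * m - 1)
  have hp1 : ((1 / 2 : ℂ) ^ (2 * m))⁻¹ = ((2 ^ (2 * m) : ℝ) : ℂ) := by
    push_cast; rw [one_div, inv_pow, inv_inv]
  -- The points 0 and 1 are symmetric about 1/2, so the factors s and s - 1 contribute equally,
  -- together -2^(2m+1) after division by (2m-1)!.
  have hp2 : ((1 / 2 - 1 : ℂ) ^ (2 * m))⁻¹ = ((2 ^ (2 * m) : ℝ) : ℂ) := by
    rw [← hp1]
    congr 1
    rw [show (1 / 2 - 1 : ℂ) = -(1 / 2) by norm_num, (even_two_mul m).neg_pow]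
  rw [iteratedDeriv_logDeriv_Gammaℝ_one_half hm, hsucc, hodd.neg_one_pow, hp1, hp2] at hxi
  have hre := congrArg Complex.re hxi
  have hneg : (-1 * ((2 * m - 1).factorial : ℂ) * ((2 ^ (2 * m) : ℝ) : ℂ))
      = ((-((2 * m - 1).factorial : ℝ) * 2 ^ (2 * m) : ℝ) : ℂ) := by push_cast; ring
  rw [hneg, Complex.add_re, Complex.add_re, Complex.add_re, Complex.ofReal_re, Complex.ofReal_re,
    ← hlog] at hre
  have hfac : ((2 * m - 1).factorial : ℝ) ≠ 0 := by positivity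
  have hpow : (2 : ℝ) ^ (2 * m) = 2 * 2 ^ (2 * m - 1) := by
    rw [← pow_succ', hsucc]
  rw [hre, vorosExpression, pow_succ 2 (2 * m), hpow]
  field_simp
  ring

theorem RiemannHypothesis.hasSum_vorosExpression (hRH : RiemannHypothesis) {m : ℕ} (hm : 1 ≤ m) :
    HasSum (fun k : ℕ => 1 / zetaOrdinate (k + 1) ^ (2 * m))
      (vorosExpression m ((1 - 1 / 2 ^ (2 * m)) * (riemannZeta (2 * (m : ℂ))).re)
        (dirichletBeta (2 * (m : ℝ)))) := by
  rw [vorosExpression_eq hm]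
  exact hRH.hasSum_zetaOrdinate hm

/-! ### Recovering the ordinates from the power sums. -/

/-- The smallest term of a sequence is recovered from its inverse power sums. -/
theorem tendsto_rpow_inv_power_sum {t : ℕ → ℝ} (h0 : ∀ k, 0 < t k) (hmono : Monotone t)
    {S : ℕ → ℝ} (hS : ∀ m, 1 ≤ m → HasSum (fun k => 1 / t k ^ (2 * m)) (S m)) :
    Tendsto (fun m : ℕ => S m ^ (-1 / (2 * (m : ℝ)))) atTop (𝓝 (t 0)) := by
  have ht := h0 0
  -- Bounding all but two of the 2m factors 1/t_k by 1/t_0 gives t_0^(-2m) ≤ S m ≤ C·t_0^(-2m).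
  -- Since C^(-1/(2m)) → 1, the multiplicity of the smallest term does not matter.
  set C : ℝ := t 0 ^ 2 * S 1 with hC
  have hlow : ∀ m, 1 ≤ m → 1 / t 0 ^ (2 * m) ≤ S m := fun m hm =>
    le_hasSum (hS m hm) 0 fun k _ => one_div_nonneg.2 (pow_nonneg (h0 k).le _)
  have hS1 : 0 < S 1 := lt_of_lt_of_le (by positivity) (hlow 1 le_rfl)
  have hC0 : 0 < C := by positivity
  have hup : ∀ m, 1 ≤ m → S m ≤ C * (1 / t 0 ^ (2 * m)) := by
    intro m hm
    have h1 := (hS 1 le_rfl).mul_left (1 / t 0 ^ (2 * (m - 1)))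
    refine (hasSum_le (fun k => ?_) (hS m hm) h1).trans (le_of_eq ?_)
    · have h2 : 2 * m = 2 * (m - 1) + 2 * 1 := by omega
      have h3 : t 0 ≤ t k := hmono (Nat.zero_le k)
      have hk := h0 k
      rw [h2, pow_add, one_div_mul_one_div]
      gcongr
    · have h2 : 2 * m = 2 * (m - 1) + 2 := by omega
      rw [h2, pow_add, hC]
      field_simp
  have hval : ∀ m : ℕ, 1 ≤ m → (1 / t 0 ^ (2 * m)) ^ (-1 / (2 * (m : ℝ))) = t 0 := by
    intro m hm
    have hm0 : (m : ℝ) ≠ 0 := by exact_mod_cast (by omega : m ≠ 0)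
    rw [one_div, ← Real.rpow_natCast, ← Real.rpow_neg ht.le, ← Real.rpow_mul ht.le]
    have : -((2 * m : ℕ) : ℝ) * (-1 / (2 * (m : ℝ))) = 1 := by
      push_cast; field_simp
    rw [this, Real.rpow_one]
  have hexp : Tendsto (fun m : ℕ => -1 / (2 * (m : ℝ))) atTop (𝓝 0) :=
    tendsto_const_nhds.div_atTop (tendsto_natCast_atTop_atTop.const_mul_atTop two_pos)
  have hlim : Tendsto (fun m : ℕ => C ^ (-1 / (2 * (m : ℝ))) * t 0) atTop (𝓝 (t 0)) := by
    have h1 := (Real.continuous_const_rpow hC0.ne').tendsto 0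
    rw [Real.rpow_zero] at h1
    simpa using (h1.comp hexp).mul_const (t 0)
  refine tendsto_of_tendsto_of_tendsto_of_le_of_le' hlim tendsto_const_nhds ?_ ?_
  · filter_upwards [eventually_ge_atTop 1] with m hm
    have hneg : -1 / (2 * (m : ℝ)) ≤ 0 := div_nonpos_of_nonpos_of_nonneg (by norm_num) (by positivity)
    have hpos : 0 < S m := lt_of_lt_of_le (by positivity) (hlow m hm)
    calc C ^ (-1 / (2 * (m : ℝ))) * t 0
        = (C * (1 / t 0 ^ (2 * m))) ^ (-1 / (2 * (m : ℝ))) := by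
          rw [Real.mul_rpow hC0.le (by positivity), hval m hm]
      _ ≤ _ := Real.rpow_le_rpow_of_nonpos hpos (hup m hm) hneg
  · filter_upwards [eventually_ge_atTop 1] with m hm
    have hneg : -1 / (2 * (m : ℝ)) ≤ 0 := div_nonpos_of_nonpos_of_nonneg (by norm_num) (by positivity)
    calc _ ≤ (1 / t 0 ^ (2 * m)) ^ (-1 / (2 * (m : ℝ))) :=
          Real.rpow_le_rpow_of_nonpos (by positivity) (hlow m hm) hneg
      _ = t 0 := hval m hm

/-- Subtracting the first n terms leaves the power sum of the tail, whose smallest member is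
`zetaOrdinate (n + 1)`. -/
theorem RiemannHypothesis.tendsto_zetaOrdinate (hRH : RiemannHypothesis) {V : ℕ → ℝ}
    (hV : ∀ m, 1 ≤ m → HasSum (fun k : ℕ => 1 / zetaOrdinate (k + 1) ^ (2 * m)) (V m)) (n : ℕ) :
    Tendsto (fun m : ℕ =>
        (V m - ∑ k ∈ Finset.Icc 1 n, 1 / zetaOrdinate k ^ (2 * m)) ^ (-1 / (2 * (m : ℝ))))
      atTop (𝓝 (zetaOrdinate (n + 1))) := by
  have h := tendsto_rpow_inv_power_sum (t := fun k => zetaOrdinate (k + n + 1))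
    (S := fun m => V m - ∑ k ∈ Finset.Icc 1 n, 1 / zetaOrdinate k ^ (2 * m))
    (fun k => (hRH.zetaOrdinate_spec (by omega)).1)
    (fun a b hab => hRH.zetaOrdinate_mono (by omega) (by omega))
    (fun m hm => by
      have h1 := (hasSum_nat_add_iff' n).2 (hV m hm)
      rwa [sum_range_eq_sum_Icc_one (fun k => 1 / zetaOrdinate k ^ (2 * m))] at h1)
  simpa using h

end

/-! ### Assembly of the theorem. -/

theorem mainTheorem2 (hRH : RiemannHypothesis) :
    -- the `zetaOrdinate n`, `n ≥ 1`, are the ordinates of all non-trivial zeros, in order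
    (∀ n : ℕ, 1 ≤ n → 0 < zetaOrdinate n ∧ zetaOrdinate n ≤ zetaOrdinate (n + 1)) ∧
    (∀ ρ : ℂ, (riemannZeta ρ = 0 ∧ 0 < ρ.re ∧ ρ.re < 1) ↔
      ∃ n : ℕ, 1 ≤ n ∧ (ρ = 1 / 2 + (zetaOrdinate n : ℂ) * Complex.I ∨
        ρ = 1 / 2 - (zetaOrdinate n : ℂ) * Complex.I)) ∧
    -- the Euler products over the odd primes
    (∀ m : ℕ, 1 ≤ m →
      Multipliable (zetaEulerFactor m) ∧
      (1 - 1 / 2 ^ (2 * m)) * riemannZeta (2 * (m : ℂ))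
        = ((∏' p : OddPrimes, zetaEulerFactor m p : ℝ) : ℂ)) ∧
    (∀ m : ℕ, 1 ≤ m →
      Multipliable (betaEulerFactor m) ∧
      dirichletBeta (2 * (m : ℝ)) = ∏' p : OddPrimes, betaEulerFactor m p) ∧
    -- the values `Z(2m)`, through `ζ` and `β` and through the primes
    (∀ m : ℕ, 1 ≤ m →
      HasSum (fun k : ℕ => 1 / zetaOrdinate (k + 1) ^ (2 * m))
        (vorosExpression m ((1 - 1 / 2 ^ (2 * m)) * (riemannZeta (2 * (m : ℂ))).re)
          (dirichletBeta (2 * (m : ℝ)))) ∧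
      HasSum (fun k : ℕ => 1 / zetaOrdinate (k + 1) ^ (2 * m))
        (vorosExpression m (∏' p : OddPrimes, zetaEulerFactor m p)
          (∏' p : OddPrimes, betaEulerFactor m p))) ∧
    -- the recurrence through `ζ` and `β`
    (∀ n : ℕ, Tendsto
      (fun m : ℕ =>
        (vorosExpression m ((1 - 1 / 2 ^ (2 * m)) * (riemannZeta (2 * (m : ℂ))).re)
            (dirichletBeta (2 * (m : ℝ)))
          - ∑ k ∈ Finset.Icc 1 n, 1 / zetaOrdinate k ^ (2 * m)) ^ (-1 / (2 * (m : ℝ))))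
      atTop (𝓝 (zetaOrdinate (n + 1)))) ∧
    -- the recurrence through the primes
    (∀ n : ℕ, Tendsto
      (fun m : ℕ =>
        (vorosExpression m (∏' p : OddPrimes, zetaEulerFactor m p)
            (∏' p : OddPrimes, betaEulerFactor m p)
          - ∑ k ∈ Finset.Icc 1 n, 1 / zetaOrdinate k ^ (2 * m)) ^ (-1 / (2 * (m : ℝ))))
      atTop (𝓝 (zetaOrdinate (n + 1)))) := by
  have hζ : ∀ m : ℕ, 1 ≤ m → ∏' p : OddPrimes, zetaEulerFactor m p
      = (1 - 1 / 2 ^ (2 * m)) * (riemannZeta (2 * (m : ℂ))).re :=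
    fun m hm => (hasProd_zetaEulerFactor hm).tprod_eq
  have hβ : ∀ m : ℕ, 1 ≤ m → ∏' p : OddPrimes, betaEulerFactor m p = dirichletBeta (2 * (m : ℝ)) :=
    fun m hm => (hasProd_betaEulerFactor hm).tprod_eq
  have hV : ∀ m : ℕ, 1 ≤ m → HasSum (fun k : ℕ => 1 / zetaOrdinate (k + 1) ^ (2 * m))
      (vorosExpression m (∏' p : OddPrimes, zetaEulerFactor m p)
        (∏' p : OddPrimes, betaEulerFactor m p)) := by
    intro m hm
    rw [hζ m hm, hβ m hm]
    exact hRH.hasSum_vorosExpression hm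
  refine ⟨fun n hn => ⟨(hRH.zetaOrdinate_spec hn).1, hRH.zetaOrdinate_mono hn n.le_succ⟩,
    hRH.nontrivial_zero_iff, fun m hm => ⟨(hasProd_zetaEulerFactor hm).multipliable, ?_⟩,
    fun m hm => ⟨(hasProd_betaEulerFactor hm).multipliable, (hβ m hm).symm⟩,
    fun m hm => ⟨hRH.hasSum_vorosExpression hm, hV m hm⟩,
    fun n => hRH.tendsto_zetaOrdinate (fun m hm => hRH.hasSum_vorosExpression hm) n,
    fun n => hRH.tendsto_zetaOrdinate hV n⟩
  rw [hζ m hm, riemannZeta_two_mul_natCast hm, Complex.ofReal_re]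
  push_cast
  rfl
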